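/- Graphs are finite and may have loops and multiple edges. Write $d_G(v)$ for the degree of a vertex $v$ (loops count twice) and $d_G(A)$ for the number of edges of $G$ with exactly one end in the vertex set $A$. A factor of $G$ is a spanning subgraph, and $G$ is edge-decomposed into factors $G_1,\ldots,G_k$ if every edge of $G$ lies in exactly one $G_i$. For an integer $\lambda\ge 0$, $G$ is odd-$\lambda$-edge-connected if $d_G(A)\ge\lambda$ for every $A\subseteq V(G)$ with $d_G(A)$ odd. Let $k\ge 1$ be an integer and let $G$ be a graph. (a) Let $\varepsilon_1,\ldots,\varepsilon_k$ be nonnegative real numbers with $\varepsilon_1+\cdots+\varepsilon_k=1$ and $\varepsilon_2=\cdots=\varepsilon_k$. Then $G$ can be edge-decomposed into factors $G_1,\ldots,G_k$ such that * for all $v\in V(G)$ and all $1\le i\le k$, $|d_{G_i}(v)-\varepsilon_i d_G(v)|<2$; * for each $v\in V(G)$, there is at most one index $j_v$ with $d_{G_{j_v}}(v)$ odd. Furthermore, if $\varepsilon_1>0$ and $G$ is odd-$\lceil 1/\varepsilon_1\rceil$-edge-connected, then such a decomposition exists for which $j_v=1$ for every vertex $v$ of odd degree in $G$. (b) $G$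 can be edge-decomposed into factors $G_1,\ldots,G_k$ such that $|d_{G_i}(v)-d_G(v)/k|<2$ for all $v\in V(G)$ and all $1\le i\le k$, and for each $v\in V(G)$ there is at most one index $j_v$ with $d_{G_{j_v}}(v)$ odd (in particular, there is no such index when $d_G(v)$ is even). Furthermore, if $G$ is odd-$k$-edge-connected, then the decomposition can be chosen with $d_{G_1}(v)\equiv d_G(v)\pmod 2$ for all $v\in V(G)$ and $d_{G_i}(v)$ even for all $v\in V(G)$ and all $2\le i\le k$; that is, $j_v=1$ for all odd-degree vertices $v$. -/

import Mathlib

namespace Graph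

variable {α β : Type*}

/-- The degree of a vertex of a multigraph: the number of edges at `v`, with every loop counted
twice. -/
noncomputable def vertexDegree (G : Graph α β) (v : α) : ℕ :=
  {e | G.IsNonloopAt e v}.ncard + 2 * {e | G.IsLoopAt e v}.ncard

/-- The number of edges of `G` with exactly one end in `A`. -/
noncomputable def cutDegree (G : Graph α β) (A : Set α) : ℕ :=
  {e | ∃ x y, G.IsLink e x y ∧ x ∈ A ∧ y ∉ A}.ncard

/-- `G` is odd-`m`-edge-connected: every edge cut of odd size has at least `m` edges. -/
def OddEdgeConnected (G : Graph α β) (m : ℕ) : Prop :=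
  ∀ A ⊆ G.vertexSet, Odd (G.cutDegree A) → m ≤ G.cutDegree A

/-- The graphs `F i` form an edge-decomposition of `G` into factors: each `F i` is a spanning
subgraph of `G`, and every edge of `G` lies in exactly one of them. -/
structure IsFactorization {ι : Type*} (G : Graph α β) (F : ι → Graph α β) : Prop where
  spanning : ∀ i, (F i).IsSpanningSubgraph G
  disjoint : ∀ i j, i ≠ j → Disjoint (F i).edgeSet (F j).edgeSet
  cover : ⋃ i, (F i).edgeSet = G.edgeSet

end Graph

/-!
Every statement reduces to two independent problems: find a first factor `F` whose degrees are close
to `ε₁ d(v)` and whose parities are under control, and colour the remaining edges evenly equitably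
with `k - 1` colours. If at each vertex the colour degrees lie in `[2q, 2q + 2]` and at most one of
them is odd, then `|d_F(v) - ε₁ d(v)| < 2` forces each of them to be within two of `ε₂ d(v)`
(`abs_part_sub_lt`, `exists_completion`). A graph is described by the map `φ` that sends the two
halves of each edge to their ends.

The colouring and, for an arbitrary graph, the first factor come from integrality of flows
(`exists_int_flow`), which is proved by linear algebra: the arcs with fractional values form a
subgraph without nodes of degree one, which carries a nonzero circulation, and following it until an
arc becomes integral reduces the number of fractional arcs. Rounding one half on every edge gives an
orientation in which in- and out-degrees differ by at most one. Rounding `ε` on every arc of such an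
orientation, in a network that has the in-degree, the out-degree and the imbalance of each vertex on
separate arcs, gives a factor (`exists_fraction`) that has equal in- and out-degree, hence even
degree, at each vertex of even degree. Doing this repeatedly with `ε = 1 / K` gives the colouring
(`exists_colouring`).

In an odd-edge-connected graph the first factor must have the degree parities of the graph. Such
factors are the perfect matchings of a gadget graph, to which Tutte's theorem applies. In a smallest
violating set `S`, each vertex is adjacent to at least three components of the rest
(`exists_violator`), which leaves only components of a simple shape (`exists_compShape`). The constant
weight `ε` on the edges extends to a fractional perfect matching of the gadget, and it puts
`ε a + (1 - ε) b` on the boundary of such a component, where `a` is odd and `a + b` is the size of a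
cut of the graph. If `b = 0`, this is at least one by odd-edge-connectivity, and otherwise it is at
least one because `a` and `b` are positive. So there are at most `|S|` odd components, a contradiction
(`exists_matching_of_weights`, `exists_gadget_matching`, `exists_parity_fraction`).
-/

namespace EquitableFactor

open Finset

/-! ### Integral flows -/

/-- The net flow out of the node `n` of the digraph with arcs `e`, from `tail e` to `head e`, when
the arc `e` carries `x e`. Loops cancel. -/
def netFlow {N E : Type*} [Fintype E] [DecidableEq N] (tail head : E → N) (x : E → ℝ) (n : N) : ℝ :=
  (∑ e, if tail e = n then x e else 0) - ∑ e, if head e = n then x e else 0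

section Flow

variable {N E : Type*} [Fintype E] [DecidableEq N] {tail head : E → N}

lemma netFlow_add (x y : E → ℝ) (n : N) :
    netFlow tail head (x + y) n = netFlow tail head x n + netFlow tail head y n := by
  simp only [netFlow, ← Finset.sum_filter, Pi.add_apply, Finset.sum_add_distrib]
  ring

lemma netFlow_smul (c : ℝ) (x : E → ℝ) (n : N) :
    netFlow tail head (c • x) n = c * netFlow tail head x n := by
  simp only [netFlow, ← Finset.sum_filter, Pi.smul_apply, smul_eq_mul, mul_sub, Finset.mul_sum]

/-- A nonempty set of arcs that has no node of degree one carries a nonzero circulation: it meets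
at most as many nodes as it has arcs, and one of the conservation laws is redundant. -/
lemma exists_circulation_ne_zero (R : Finset E) (hR : R.Nonempty)
    (h : ∀ n, #{e ∈ R | tail e = n} + #{e ∈ R | head e = n} ≠ 1) :
    ∃ z : E → ℝ, z ≠ 0 ∧ (∀ e ∉ R, z e = 0) ∧ ∀ n, netFlow tail head z n = 0 := by
  classical
  set M : Finset N := R.image tail ∪ R.image head with hM
  have htail : ∀ e ∈ R, tail e ∈ M := fun e he =>
    mem_union_left _ (mem_image_of_mem _ he)
  have hhead : ∀ e ∈ R, head e ∈ M := fun e he =>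
    mem_union_right _ (mem_image_of_mem _ he)
  have hcard : #M ≤ #R := by
    have h1 := card_eq_sum_card_fiberwise (f := tail) (s := R) (t := M) htail
    have h2 := card_eq_sum_card_fiberwise (f := head) (s := R) (t := M) hhead
    have h3 : ∑ n ∈ M, 2 ≤ ∑ n ∈ M, (#{e ∈ R | tail e = n} + #{e ∈ R | head e = n}) := by
      refine sum_le_sum fun n hn => ?_
      have h4 : 0 < #{e ∈ R | tail e = n} + #{e ∈ R | head e = n} := by
        rcases mem_union.1 hn with hn | hn
        · obtain ⟨e, he, hen⟩ := mem_image.1 hn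
          have : 0 < #{e ∈ R | tail e = n} := card_pos.2 ⟨e, by simp [he, hen]⟩
          omega
        · obtain ⟨e, he, hen⟩ := mem_image.1 hn
          have : 0 < #{e ∈ R | head e = n} := card_pos.2 ⟨e, by simp [he, hen]⟩
          omega
      have := h n
      omega
    rw [sum_add_distrib, ← h1, ← h2, sum_const, smul_eq_mul] at h3
    omega
  obtain ⟨e₀, he₀⟩ := hR
  have hn₀ := htail e₀ he₀
  let L : (E → ℝ) →ₗ[ℝ] ((M.erase (tail e₀) : Finset N) ⊕ (Rᶜ : Finset E) → ℝ) :=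
    { toFun := fun z i => 
        Sum.elim (fun n : (M.erase (tail e₀) : Finset N) => netFlow tail head z n.1)
          (fun e : (Rᶜ : Finset E) => z e.1) i
      map_add' := by
        intro x y; ext i; rcases i with i | i <;> simp [netFlow_add]
      map_smul' := by
        intro c x; ext i; rcases i with i | i <;> simp [netFlow_smul] }
  have hker : LinearMap.ker L ≠ ⊥ := by
    apply LinearMap.ker_ne_bot_of_finrank_lt
    simp only [Module.finrank_fintype_fun_eq_card, Fintype.card_sum, Fintype.card_coe,
      card_erase_of_mem hn₀, card_compl]
    have := card_le_univ R
    have : 0 < #R := card_pos.2 ⟨e₀, he₀⟩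
    have : 0 < #M := card_pos.2 ⟨_, hn₀⟩
    rw [← Finset.card_univ] at *
    omega
  obtain ⟨z, hz, hz0⟩ := Submodule.exists_mem_ne_zero_of_ne_bot hker
  have hz' : ∀ i, L z i = 0 := fun i => by rw [LinearMap.mem_ker.1 hz]; rfl
  have hzR : ∀ e ∉ R, z e = 0 := fun e he => hz' (Sum.inr ⟨e, by simpa using he⟩)
  have hzM : ∀ n ∈ M, n ≠ tail e₀ → netFlow tail head z n = 0 := fun n hn hne =>
    hz' (Sum.inl ⟨n, mem_erase.2 ⟨hne, hn⟩⟩)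
  refine ⟨z, hz0, hzR, fun n => ?_⟩
  by_cases hn : n ∈ M
  · by_cases hne : n = tail e₀
    · -- the net flows add up to zero, so the law at the last node follows from the others
      have hsum : ∑ m ∈ M, netFlow tail head z m = 0 := by
        simp only [netFlow, sum_sub_distrib]
        rw [sum_comm, sum_comm (s := M)]
        rw [sub_eq_zero]
        refine sum_congr rfl fun e _ => ?_
        by_cases he : e ∈ R
        · simp [htail e he, hhead e he]
        · simp [hzR e he]
      rw [sum_eq_single_of_mem n hn] at hsum
      · exact hsum
      · intro m hm hmn
        exact hzM m hm (hne ▸ hmn)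
    · exact hzM n hn hne
  · have : ∀ e, (tail e = n → z e = 0) ∧ (head e = n → z e = 0) := by
      intro e
      by_cases he : e ∈ R
      · exact ⟨fun h => absurd (h ▸ htail e he) hn, fun h => absurd (h ▸ hhead e he) hn⟩
      · simp [hzR e he]
    rw [netFlow, sum_eq_zero, sum_eq_zero, sub_zero]
    · intro e _
      split_ifs with h
      exacts [(this e).2 h, rfl]
    · intro e _
      split_ifs with h
      exacts [(this e).1 h, rfl]

/-- Where the net flow is integral, the arcs with a fractional value do not have degree one. -/
lemma card_fract_ne_one (x : E → ℝ) (n : N) (hn : ∃ z : ℤ, netFlow tail head x n = z) :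
    #{e ∈ ({e | Int.fract (x e) ≠ 0} : Finset E) | tail e = n} +
      #{e ∈ ({e | Int.fract (x e) ≠ 0} : Finset E) | head e = n} ≠ 1 := by
  obtain ⟨z, hz⟩ := hn
  have key : ∀ f : E → N, (∑ e, if f e = n then x e else 0) =
      ((∑ e, if f e = n then ⌊x e⌋ else 0 : ℤ) : ℝ) +
        ∑ e ∈ ({e | Int.fract (x e) ≠ 0} : Finset E) with f e = n, Int.fract (x e) := by
    intro f
    rw [Finset.filter_filter, Finset.sum_filter]
    push_cast
    rw [← Finset.sum_add_distrib]
    refine Finset.sum_congr rfl fun e _ => ?_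
    by_cases h1 : f e = n <;> by_cases h2 : Int.fract (x e) = 0
    · have := Int.floor_add_fract (x e)
      simp [h1, h2]; linarith
    · simp [h1, h2]
    · simp [h1]
    · simp [h1]
  have aux : ∀ (s : Finset E), (s ⊆ ({e | Int.fract (x e) ≠ 0} : Finset E)) → #s = 1 →
      ∀ m : ℤ, ∑ e ∈ s, Int.fract (x e) ≠ m := by
    intro s hs h1 m hm
    obtain ⟨e, rfl⟩ := card_eq_one.1 h1
    rw [sum_singleton] at hm
    have h2 : Int.fract (x e) ≠ 0 := by simpa using hs (mem_singleton_self e)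
    have h3 := Int.fract_nonneg (x e)
    have h4 := Int.fract_lt_one (x e)
    rw [hm] at h2 h3 h4
    norm_cast at h2 h3 h4
    omega
  intro h1
  rw [netFlow, key, key] at hz
  rcases Nat.add_eq_one_iff.1 h1 with ⟨ha, hb⟩ | ⟨ha, hb⟩
  · rw [card_eq_zero.1 ha, sum_empty] at hz
    refine aux _ (filter_subset _ _) hb ((∑ e, if tail e = n then ⌊x e⌋ else 0 : ℤ) -
      (∑ e, if head e = n then ⌊x e⌋ else 0 : ℤ) - z) ?_
    push_cast at hz ⊢
    linarith
  · rw [card_eq_zero.1 hb, sum_empty] at hz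
    refine aux _ (filter_subset _ _) ha (z - (∑ e, if tail e = n then ⌊x e⌋ else 0 : ℤ) +
      (∑ e, if head e = n then ⌊x e⌋ else 0 : ℤ)) ?_
    push_cast at hz ⊢
    linarith

/-- A nonzero direction can be followed until a first fractional coordinate reaches an integer. -/
lemma exists_step_to_int (x z : E → ℝ) (hz : z ≠ 0) (hzx : ∀ e, Int.fract (x e) = 0 → z e = 0) :
    ∃ t : ℝ, (∀ e, ⌊x e⌋ ≤ x e + t * z e ∧ x e + t * z e ≤ ⌈x e⌉) ∧
      ∃ e, Int.fract (x e) ≠ 0 ∧ Int.fract (x e + t * z e) = 0 := by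
  classical
  -- the distance to the integer ahead of `x e` in the direction of `z e`
  let τ : E → ℝ := fun e => if 0 < z e then (⌈x e⌉ - x e) / z e else (⌊x e⌋ - x e) / z e
  have hne : ({e | z e ≠ 0} : Finset E).Nonempty := by
    obtain ⟨e, he⟩ := Function.ne_iff.1 hz
    exact ⟨e, by simpa using he⟩
  obtain ⟨e₀, he₀, hmin⟩ := exists_min_image _ τ hne
  have hz₀ : z e₀ ≠ 0 := by simpa using he₀
  have hτ0 : ∀ e, 0 ≤ τ e := by
    intro e
    simp only [τ]
    split_ifs with h
    · exact div_nonneg (by linarith [Int.le_ceil (x e)]) h.le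
    · exact div_nonneg_of_nonpos (by linarith [Int.floor_le (x e)]) (not_lt.1 h)
  refine ⟨τ e₀, fun e => ?_, e₀, fun h => hz₀ (hzx _ h), ?_⟩
  · have h1 := Int.floor_le (x e)
    have h2 := Int.le_ceil (x e)
    rcases lt_trichotomy (z e) 0 with h | h | h
    · have h3 : τ e₀ ≤ τ e := hmin e (by simp [h.ne])
      have h4 : τ e * z e = ⌊x e⌋ - x e := by
        simp only [τ, if_neg (not_lt.2 h.le)]
        exact div_mul_cancel₀ _ h.ne
      have h5 : τ e * z e ≤ τ e₀ * z e := mul_le_mul_of_nonpos_right h3 h.le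
      have h6 : τ e₀ * z e ≤ 0 := mul_nonpos_of_nonneg_of_nonpos (hτ0 _) h.le
      constructor <;> linarith
    · rw [h, mul_zero, add_zero]
      exact ⟨h1, h2⟩
    · have h3 : τ e₀ ≤ τ e := hmin e (by simp [h.ne'])
      have h4 : τ e * z e = ⌈x e⌉ - x e := by
        simp only [τ, if_pos h]
        exact div_mul_cancel₀ _ h.ne'
      have h5 : τ e₀ * z e ≤ τ e * z e := mul_le_mul_of_nonneg_right h3 h.le
      have h6 : 0 ≤ τ e₀ * z e := mul_nonneg (hτ0 _) h.le
      constructor <;> linarith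
  · simp only [τ]
    split_ifs with h
    · rw [div_mul_cancel₀ _ hz₀, add_sub_cancel, Int.fract_intCast]
    · rw [div_mul_cancel₀ _ hz₀, add_sub_cancel, Int.fract_intCast]

/-- **Integrality of flows**: a real flow with integral net flow at every node can be rounded, each
arc up or down, to an integral flow with the same net flows. -/
theorem exists_int_flow (x : E → ℝ) (hx : ∀ n, ∃ z : ℤ, netFlow tail head x n = z) :
    ∃ y : E → ℤ, (∀ e, ⌊x e⌋ ≤ y e ∧ y e ≤ ⌈x e⌉) ∧
      ∀ n, netFlow tail head (fun e => (y e : ℝ)) n = netFlow tail head x n := by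
  classical
  induction hm : #({e | Int.fract (x e) ≠ 0} : Finset E) using Nat.strong_induction_on
    generalizing x with
  | _ m ih =>
    subst hm
    by_cases hR : ({e | Int.fract (x e) ≠ 0} : Finset E).Nonempty
    · obtain ⟨z, hz0, hzR, hz⟩ := exists_circulation_ne_zero (tail := tail) (head := head) _ hR
        fun n => card_fract_ne_one x n (hx n)
      have hzx : ∀ e, Int.fract (x e) = 0 → z e = 0 := fun e he => hzR e (by simpa using he)
      obtain ⟨t, ht, e₁, he₁, he₁'⟩ := exists_step_to_int x z hz0 hzx
      have hnet : ∀ n, netFlow tail head (x + t • z) n = netFlow tail head x n := fun n => by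
        rw [netFlow_add, netFlow_smul, hz, mul_zero, add_zero]
      obtain ⟨y, hy, hyn⟩ := ih _ (card_lt_card (s := {e | Int.fract ((x + t • z) e) ≠ 0}) (by
          rw [Finset.ssubset_iff_of_subset]
          · exact ⟨e₁, by simpa using he₁, by simpa using he₁'⟩
          · intro e he
            simp only [mem_filter, mem_univ, true_and] at he ⊢
            intro h
            apply he
            simp [hzx e h, h])) (x + t • z) (fun n => by rw [hnet]; exact hx n) rfl
      refine ⟨y, fun e => ⟨?_, ?_⟩, fun n => by rw [hyn, hnet]⟩
      · exact (Int.le_floor.2 (ht e).1).trans (hy e).1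
      · exact (hy e).2.trans (Int.ceil_le.2 (ht e).2)
    · have h0 : ∀ e, Int.fract (x e) = 0 := fun e => by
        by_contra h
        exact hR ⟨e, by simpa using h⟩
      refine ⟨fun e => ⌊x e⌋, fun e => ⟨le_rfl, Int.floor_le_ceil _⟩, fun n => ?_⟩
      congr 1
      ext e
      have := Int.floor_add_fract (x e)
      rw [h0, add_zero] at this
      exact this

/-- The form in which rounding of flows is used: every arc changes by less than one. -/
theorem exists_int_flow_abs_sub_lt (x : E → ℝ) (hx : ∀ n, ∃ z : ℤ, netFlow tail head x n = z) :
    ∃ y : E → ℤ, (∀ e, |(y e : ℝ) - x e| < 1) ∧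
      ∀ n, netFlow tail head (fun e => (y e : ℝ)) n = netFlow tail head x n := by
  obtain ⟨y, hy, hyn⟩ := exists_int_flow x hx
  refine ⟨y, fun e => abs_sub_lt_iff.2 ⟨?_, ?_⟩, hyn⟩
  · have h1 : (y e : ℝ) ≤ ⌈x e⌉ := by exact_mod_cast (hy e).2
    linarith [Int.ceil_lt_add_one (x e)]
  · have h1 : (⌊x e⌋ : ℝ) ≤ y e := by exact_mod_cast (hy e).1
    linarith [Int.lt_floor_add_one (x e)]

end Flow

/-! ### Balanced orientations and equitable splittings -/

section Orientation

variable {V E : Type*} [DecidableEq V]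

/-- The number of elements of `s` that `f` attaches to `v`. For a set of arcs, with `f` the tail or
the head map, this is the out-degree or the in-degree. -/
def endDegree (f : E → V) (s : Finset E) (v : V) : ℕ := #{e ∈ s | f e = v}

/-- The degree of `v` in the spanning subgraph with edge set `s`. The ends of the edge `e` are
`φ (e, false)` and `φ (e, true)`, so loops count twice. -/
def halfDegree (φ : E × Bool → V) (s : Finset E) (v : V) : ℕ :=
  endDegree (fun e => φ (e, false)) s v + endDegree (fun e => φ (e, true)) s v

lemma sum_endDegree [Fintype V] (f : E → V) (s : Finset E) : ∑ v, endDegree f s v = #s :=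
  (card_eq_sum_card_fiberwise (f := f) (s := s) (t := univ) fun _ _ => mem_univ _).symm

lemma endDegree_add_of_disjoint [DecidableEq E] (f : E → V) {s t : Finset E} (h : Disjoint s t)
    (v : V) : endDegree f (s ∪ t) v = endDegree f s v + endDegree f t v := by
  rw [endDegree, filter_union, card_union_of_disjoint (disjoint_filter_filter h)]
  rfl

lemma halfDegree_add_of_disjoint [DecidableEq E] (φ : E × Bool → V) {s t : Finset E}
    (h : Disjoint s t) (v : V) : halfDegree φ (s ∪ t) v = halfDegree φ s v + halfDegree φ t v := by
  simp only [halfDegree, endDegree_add_of_disjoint _ h]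
  ring

lemma endDegree_eq_sum [Fintype E] [DecidableEq E] (f : E → V) (s : Finset E) (v : V) :
    (endDegree f s v : ℝ) = ∑ e, if f e = v then (if e ∈ s then 1 else 0) else 0 := by
  rw [endDegree, card_eq_sum_ones, sum_filter]
  push_cast
  rw [← sum_filter_add_sum_filter_not univ (· ∈ s), filter_mem_eq_inter, univ_inter,
    sum_eq_zero (s := {e | e ∉ s}), add_zero]
  · exact sum_congr rfl fun e he => by simp [he]
  · intro e he
    simp [(mem_filter.1 he).2]

lemma halfDegree_orient (φ : E × Bool → V) (o : E → Bool) (s : Finset E) (v : V) :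
    endDegree (fun e => φ (e, o e)) s v + endDegree (fun e => φ (e, !o e)) s v =
      halfDegree φ s v := by
  simp only [halfDegree, endDegree, card_filter, ← sum_add_distrib]
  refine sum_congr rfl fun e _ => ?_
  cases o e
  · rfl
  · exact add_comm _ _

lemma endDegree_subtype (f : E → V) (s : Finset E) (v : V) :
    endDegree (fun e : s => f e) univ v = endDegree f s v := by
  simp only [endDegree, card_filter]
  exact sum_coe_sort s fun e => if f e = v then 1 else 0

variable [Fintype V] [Fintype E]

/-- Every finite graph has an orientation in which the out-degree and the in-degree of each vertex
differ by at most one: round the half-integral flow that sends one half along every edge, with the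
imbalance at each vertex carried off to an additional node. -/
theorem exists_balanced_orientation (φ : E × Bool → V) :
    ∃ o : E → Bool, ∀ v,
      |(endDegree (fun e => φ (e, !o e)) univ v : ℤ) - endDegree (fun e => φ (e, o e)) univ v| ≤ 1 := by
  classical
  set f : E → V := fun e => φ (e, false) with hf
  set g : E → V := fun e => φ (e, true) with hg
  let tail : E ⊕ V → Option V := Sum.elim (fun e => some (f e)) some
  let head : E ⊕ V → Option V := Sum.elim (fun e => some (g e)) (fun _ => none)
  have hsome : ∀ (x : E ⊕ V → ℝ) v, netFlow tail head x (some v) =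
      (∑ e, if f e = v then x (Sum.inl e) else 0) + x (Sum.inr v) -
        ∑ e, if g e = v then x (Sum.inl e) else 0 := by
    intro x v
    simp [netFlow, tail, head, Fintype.sum_sum_type]
  have hnone : ∀ x : E ⊕ V → ℝ, netFlow tail head x none = -∑ v, x (Sum.inr v) := by
    intro x
    simp [netFlow, tail, head, Fintype.sum_sum_type]
  let x : E ⊕ V → ℝ := Sum.elim (fun _ => 1 / 2)
    (fun v => ((endDegree g univ v : ℝ) - endDegree f univ v) / 2)
  have hdeg : ∀ (h : E → V) v, (∑ e, if h e = v then (1 / 2 : ℝ) else 0) =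
      (endDegree h univ v : ℝ) / 2 := by
    intro h v
    rw [endDegree, ← sum_filter, sum_const, nsmul_eq_mul]
    ring
  have hx : ∀ n, netFlow tail head x n = 0 := by
    rintro (_ | v)
    · have h1 : ∑ v, (endDegree g univ v : ℝ) = #(univ : Finset E) := by
        exact_mod_cast sum_endDegree g univ
      have h2 : ∑ v, (endDegree f univ v : ℝ) = #(univ : Finset E) := by
        exact_mod_cast sum_endDegree f univ
      rw [hnone]
      simp only [x, Sum.elim_inr]
      rw [← sum_div, sum_sub_distrib, h1, h2]
      simp
    · rw [hsome]
      simp only [x, Sum.elim_inr, Sum.elim_inl, hdeg]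
      ring
  obtain ⟨y, hy, hyn⟩ := exists_int_flow_abs_sub_lt x fun n => ⟨0, by rw [hx]; simp⟩
  -- an edge is reversed when it carries one unit
  have hy01 : ∀ e, y (Sum.inl e) = 0 ∨ y (Sum.inl e) = 1 := by
    intro e
    have h := abs_sub_lt_iff.1 (hy (Sum.inl e))
    simp only [x, Sum.elim_inl] at h
    have h1 : y (Sum.inl e) < 2 := by
      have : (y (Sum.inl e) : ℝ) < 2 := by linarith
      exact_mod_cast this
    have h2 : -1 < y (Sum.inl e) := by
      have : (-1 : ℝ) < (y (Sum.inl e) : ℝ) := by linarith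
      exact_mod_cast this
    omega
  refine ⟨fun e => decide (y (Sum.inl e) = 1), fun v => ?_⟩
  have h0 := hyn (some v)
  rw [hx, hsome] at h0
  have hb := abs_sub_lt_iff.1 (hy (Sum.inr v))
  simp only [x, Sum.elim_inr] at hb
  have hdiff : (endDegree (fun e => φ (e, !decide (y (Sum.inl e) = 1))) univ v : ℝ) -
      endDegree (fun e => φ (e, decide (y (Sum.inl e) = 1))) univ v =
      (endDegree g univ v : ℝ) - endDegree f univ v +
        2 * ((∑ e, if f e = v then (y (Sum.inl e) : ℝ) else 0) -
          ∑ e, if g e = v then (y (Sum.inl e) : ℝ) else 0) := by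
    simp only [endDegree_eq_sum, mem_univ, if_true, ← sum_sub_distrib, mul_sum, ← sum_add_distrib]
    refine sum_congr rfl fun e _ => ?_
    rcases hy01 e with h | h
    · simp [h, f, g]
    · simp only [h, decide_true, Bool.not_true, f, g]
      push_cast
      split_ifs <;> norm_num
  have h3 : |((endDegree (fun e => φ (e, !decide (y (Sum.inl e) = 1))) univ v : ℝ) -
      endDegree (fun e => φ (e, decide (y (Sum.inl e) = 1))) univ v)| < 2 := by
    rw [hdiff, abs_lt]
    constructor <;> linarith [hb.1, hb.2]
  have h4 : |(endDegree (fun e => φ (e, !decide (y (Sum.inl e) = 1))) univ v : ℤ) -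
      endDegree (fun e => φ (e, decide (y (Sum.inl e) = 1))) univ v| < 2 := by
    exact_mod_cast h3
  exact Int.le_of_lt_add_one h4

omit [Fintype E] in
lemma exists_balanced_orientation_on (φ : E × Bool → V) (s : Finset E) :
    ∃ o : E → Bool, ∀ v,
      |(endDegree (fun e => φ (e, !o e)) s v : ℤ) - endDegree (fun e => φ (e, o e)) s v| ≤ 1 := by
  classical
  obtain ⟨o, ho⟩ := exists_balanced_orientation fun h : s × Bool => φ (h.1, h.2)
  refine ⟨fun e => if h : e ∈ s then o ⟨e, h⟩ else false, fun v => ?_⟩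
  have h := ho v
  rw [← endDegree_subtype (fun e => φ (e, !_)), ← endDegree_subtype (fun e => φ (e, _))]
  simpa only [Finset.coe_mem, dite_true, Subtype.coe_eta] using h

/-- The fraction `ε` of a digraph: out-degrees, in-degrees and imbalances are simultaneously rounded
versions of `ε` times the original ones. In the flow network, the vertex `v` becomes a path
`(v, 0) → (v, 1) → (v, 2)` that carries the in-degree on its first arc and the out-degree on its
second one, and the imbalance leaves the middle node. -/
theorem exists_fraction (tail head : E → V) (s : Finset E) (ε : ℝ) (h0 : 0 ≤ ε) (h1 : ε ≤ 1) :
    ∃ F ⊆ s, ∀ v,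
      |(endDegree tail F v : ℝ) - ε * endDegree tail s v| < 1 ∧
      |(endDegree head F v : ℝ) - ε * endDegree head s v| < 1 ∧
      |((endDegree head F v : ℝ) - endDegree tail F v) -
        ε * ((endDegree head s v : ℝ) - endDegree tail s v)| < 1 := by
  classical
  let tl : E ⊕ (V ⊕ V ⊕ V) → Option (V × Fin 3) := Sum.elim (fun e => some (tail e, 2))
    (Sum.elim (fun v => some (v, 0)) (Sum.elim (fun v => some (v, 1)) (fun v => some (v, 1))))
  let hd : E ⊕ (V ⊕ V ⊕ V) → Option (V × Fin 3) := Sum.elim (fun e => some (head e, 0))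
    (Sum.elim (fun v => some (v, 1)) (Sum.elim (fun v => some (v, 2)) (fun _ => none)))
  have hn0 : ∀ x v, netFlow tl hd x (some (v, 0)) =
      x (Sum.inr (Sum.inl v)) - ∑ e, if head e = v then x (Sum.inl e) else 0 := by
    intro x v
    simp [netFlow, tl, hd, Fintype.sum_sum_type]
  have hn1 : ∀ x v, netFlow tl hd x (some (v, 1)) =
      x (Sum.inr (Sum.inr (Sum.inl v))) + x (Sum.inr (Sum.inr (Sum.inr v))) -
        x (Sum.inr (Sum.inl v)) := by
    intro x v
    simp [netFlow, tl, hd, Fintype.sum_sum_type]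
  have hn2 : ∀ x v, netFlow tl hd x (some (v, 2)) =
      (∑ e, if tail e = v then x (Sum.inl e) else 0) - x (Sum.inr (Sum.inr (Sum.inl v))) := by
    intro x v
    simp [netFlow, tl, hd, Fintype.sum_sum_type]
  have hnz : ∀ x, netFlow tl hd x none = -∑ v, x (Sum.inr (Sum.inr (Sum.inr v))) := by
    intro x
    simp [netFlow, tl, hd, Fintype.sum_sum_type]
  let x : E ⊕ (V ⊕ V ⊕ V) → ℝ := Sum.elim (fun e => if e ∈ s then ε else 0)
    (Sum.elim (fun v => ε * endDegree head s v) (Sum.elim (fun v => ε * endDegree tail s v)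
      (fun v => ε * ((endDegree head s v : ℝ) - endDegree tail s v))))
  have hdeg : ∀ (f : E → V) v, (∑ e, if f e = v then (if e ∈ s then ε else 0) else 0) =
      ε * endDegree f s v := by
    intro f v
    rw [endDegree_eq_sum, mul_sum]
    refine sum_congr rfl fun e _ => ?_
    split_ifs <;> simp
  have hx : ∀ n, netFlow tl hd x n = 0 := by
    rintro (_ | ⟨v, i⟩)
    · have h1 : ∑ v, (endDegree head s v : ℝ) = #s := by
        exact_mod_cast sum_endDegree head s
      have h2 : ∑ v, (endDegree tail s v : ℝ) = #s := by
        exact_mod_cast sum_endDegree tail s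
      rw [hnz]
      simp only [x, Sum.elim_inr]
      rw [← mul_sum, sum_sub_distrib, h1, h2]
      simp
    · fin_cases i
      · refine (hn0 x v).trans ?_
        simp only [x, Sum.elim_inr, Sum.elim_inl, hdeg]
        ring
      · refine (hn1 x v).trans ?_
        simp only [x, Sum.elim_inr, Sum.elim_inl]
        ring
      · refine (hn2 x v).trans ?_
        simp only [x, Sum.elim_inr, Sum.elim_inl, hdeg]
        ring
  obtain ⟨y, hy, hyn⟩ := exists_int_flow_abs_sub_lt x fun n => ⟨0, by rw [hx]; simp⟩
  have hy01 : ∀ e, (y (Sum.inl e) = 0 ∨ y (Sum.inl e) = 1) ∧ (e ∉ s → y (Sum.inl e) = 0) := by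
    intro e
    have h := abs_sub_lt_iff.1 (hy (Sum.inl e))
    simp only [x, Sum.elim_inl] at h
    split_ifs at h with hes
    · have h1 : y (Sum.inl e) < 2 := by
        have : (y (Sum.inl e) : ℝ) < 2 := by linarith
        exact_mod_cast this
      have h2 : -1 < y (Sum.inl e) := by
        have : (-1 : ℝ) < (y (Sum.inl e) : ℝ) := by linarith
        exact_mod_cast this
      exact ⟨by omega, fun h => absurd hes h⟩
    · have h1 : y (Sum.inl e) < 1 := by
        have : (y (Sum.inl e) : ℝ) < 1 := by linarith
        exact_mod_cast this
      have h2 : -1 < y (Sum.inl e) := by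
        have : (-1 : ℝ) < (y (Sum.inl e) : ℝ) := by linarith
        exact_mod_cast this
      exact ⟨by omega, fun _ => by omega⟩
  have hF : ∀ (f : E → V) v, (∑ e, if f e = v then (y (Sum.inl e) : ℝ) else 0) =
      endDegree f {e | y (Sum.inl e) = 1} v := by
    intro f v
    rw [endDegree_eq_sum]
    refine sum_congr rfl fun e _ => ?_
    rcases (hy01 e).1 with h | h <;> simp [h]
  refine ⟨({e | y (Sum.inl e) = 1} : Finset E), fun e he => ?_, fun v => ?_⟩
  · by_contra hes
    have := (hy01 e).2 hes
    rw [mem_filter] at he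
    omega
  · have e0 := hyn (some (v, 0))
    have e1 := hyn (some (v, 1))
    have e2 := hyn (some (v, 2))
    rw [hx, hn0, hF] at e0
    rw [hx, hn1] at e1
    rw [hx, hn2, hF] at e2
    have b0 := hy (Sum.inr (Sum.inl v))
    have b1 := hy (Sum.inr (Sum.inr (Sum.inl v)))
    have b2 := hy (Sum.inr (Sum.inr (Sum.inr v)))
    simp only [x, Sum.elim_inr, Sum.elim_inl] at b0 b1 b2
    refine ⟨?_, ?_, ?_⟩
    · rwa [sub_eq_zero.1 e2]
    · rwa [← sub_eq_zero.1 e0]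
    · rwa [← sub_eq_zero.1 e0, sub_eq_zero.1 e2, ← sub_eq_zero.1 e1, add_sub_cancel_left]

/-- A fraction of an undirected graph, without any condition on the graph: the degrees are within
two of the prescribed ones, and even degrees stay even. -/
theorem exists_fraction_even (φ : E × Bool → V) (ε : ℝ) (h0 : 0 ≤ ε) (h1 : ε ≤ 1) :
    ∃ F : Finset E, ∀ v, |(halfDegree φ F v : ℝ) - ε * halfDegree φ univ v| < 2 ∧
      (Even (halfDegree φ univ v) → Even (halfDegree φ F v)) := by
  obtain ⟨o, ho⟩ := exists_balanced_orientation φ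
  obtain ⟨F, -, hF⟩ := exists_fraction (fun e => φ (e, o e)) (fun e => φ (e, !o e)) univ ε h0 h1
  refine ⟨F, fun v => ?_⟩
  obtain ⟨hT, hH, hD⟩ := hF v
  have hv := ho v
  rw [← halfDegree_orient φ o F v, ← halfDegree_orient φ o univ v]
  generalize endDegree (fun e => φ (e, o e)) univ v = a at *
  generalize endDegree (fun e => φ (e, !o e)) univ v = b at *
  generalize endDegree (fun e => φ (e, o e)) F v = a' at *
  generalize endDegree (fun e => φ (e, !o e)) F v = b' at *
  constructor
  · rw [abs_lt] at *
    push_cast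
    constructor <;> linarith [hT.1, hT.2, hH.1, hH.2]
  · intro hab
    have hba : b = a := by
      rw [abs_le] at hv
      obtain ⟨c, hc⟩ := hab
      omega
    subst hba
    rw [sub_self, mul_zero, sub_zero] at hD
    have hD' : |(b' : ℤ) - a'| < 1 := by exact_mod_cast hD
    have hba' : a' = b' := by
      rw [Int.abs_lt_one_iff] at hD'
      omega
    exact ⟨b', by rw [hba']⟩

/-! ### Evenly equitable colourings -/

/-- Repeatedly extracting the fraction `1 / K` of what remains, for decreasing `K`, colours the arcs
of a nearly balanced digraph equitably, with an imbalance in at most one colour at each vertex. The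
bounds `p` and `q` on the averages of the out- and in-degrees are inherited by the remaining arcs. -/
theorem exists_arc_colouring (tail head : E → V) (K : ℕ) (s : Finset E) (p q : V → ℕ)
    (hp : ∀ v, K * p v ≤ endDegree tail s v ∧ endDegree tail s v ≤ K * (p v + 1))
    (hq : ∀ v, K * q v ≤ endDegree head s v ∧ endDegree head s v ≤ K * (q v + 1))
    (hb : ∀ v, |(endDegree head s v : ℤ) - endDegree tail s v| ≤ 1) :
    ∃ c : E → ℕ, (∀ e ∈ s, c e < K) ∧ ∀ v,
      (∀ i < K, p v ≤ endDegree tail {e ∈ s | c e = i} v ∧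
        endDegree tail {e ∈ s | c e = i} v ≤ p v + 1 ∧
        q v ≤ endDegree head {e ∈ s | c e = i} v ∧
        endDegree head {e ∈ s | c e = i} v ≤ q v + 1) ∧
      (endDegree tail s v = endDegree head s v →
        ∀ i < K, endDegree tail {e ∈ s | c e = i} v = endDegree head {e ∈ s | c e = i} v) ∧
      (∀ i < K, ∀ j < K,
        endDegree tail {e ∈ s | c e = i} v ≠ endDegree head {e ∈ s | c e = i} v →
        endDegree tail {e ∈ s | c e = j} v ≠ endDegree head {e ∈ s | c e = j} v → i = j) := by
  classical
  induction K generalizing s with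
  | zero =>
    refine ⟨fun _ => 0, fun e he => ?_, fun v => ⟨by simp, by simp, by simp⟩⟩
    have h := (hp (tail e)).2
    rw [zero_mul, Nat.le_zero, endDegree, card_eq_zero, filter_eq_empty_iff] at h
    exact absurd rfl (h he)
  | succ K ih =>
    have hK : (0 : ℝ) < K + 1 := by positivity
    obtain ⟨F, hFs, hF⟩ := exists_fraction tail head s (1 / ((K : ℝ) + 1)) (by positivity)
      (by rw [div_le_one hK]; linarith [(Nat.cast_nonneg K : (0 : ℝ) ≤ K)])
    -- the extracted class and the rest both stay within the bounds
    have hround : ∀ f : E → V, ∀ v,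
        |(endDegree f F v : ℝ) - 1 / ((K : ℝ) + 1) * endDegree f s v| < 1 →
        |((K : ℤ) + 1) * endDegree f F v - endDegree f s v| < K + 1 := by
      intro f v h
      have h2 : |((K : ℝ) + 1) * endDegree f F v - endDegree f s v| < K + 1 := by
        have : ((K : ℝ) + 1) * endDegree f F v - endDegree f s v =
            (K + 1) * ((endDegree f F v : ℝ) - 1 / ((K : ℝ) + 1) * endDegree f s v) := by
          field_simp
        rw [this, abs_mul, abs_of_pos hK]
        nlinarith
      exact_mod_cast h2
    have hsplit : ∀ f : E → V, ∀ v,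
        endDegree f s v = endDegree f F v + endDegree f (s \ F) v := by
      intro f v
      rw [← endDegree_add_of_disjoint f disjoint_sdiff, union_sdiff_of_subset hFs]
    have hbounds : ∀ f : E → V, ∀ v (r : ℕ),
        |((K : ℤ) + 1) * endDegree f F v - endDegree f s v| < K + 1 →
        (K + 1) * r ≤ endDegree f s v ∧ endDegree f s v ≤ (K + 1) * (r + 1) →
        r ≤ endDegree f F v ∧ endDegree f F v ≤ r + 1 ∧
        K * r ≤ endDegree f (s \ F) v ∧ endDegree f (s \ F) v ≤ K * (r + 1) := by
      intro f v r h ⟨h1, h2⟩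
      rw [abs_lt] at h
      have h3 := hsplit f v
      generalize endDegree f s v = a at *
      generalize endDegree f F v = b at *
      generalize endDegree f (s \ F) v = c at *
      subst h3
      zify at h1 h2 ⊢
      push_cast at h
      have hrb : (r : ℤ) ≤ b := by
        by_contra hlt
        have : (b : ℤ) + 1 ≤ r := by omega
        nlinarith
      have hbr : (b : ℤ) ≤ r + 1 := by
        by_contra hlt
        have : (r : ℤ) + 2 ≤ b := by omega
        nlinarith
      refine ⟨hrb, hbr, ?_, ?_⟩
      · rcases eq_or_lt_of_le hrb with hr | hr
        · rw [← hr] at h1; linarith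
        · have : (b : ℤ) = r + 1 := by omega
          rw [this] at h; nlinarith [h.2]
      · rcases eq_or_lt_of_le hrb with hr | hr
        · rw [← hr] at h; nlinarith [h.1]
        · have : (b : ℤ) = r + 1 := by omega
          rw [this] at h2; linarith
    have htail := fun v => hbounds tail v (p v) (hround tail v (hF v).1) (hp v)
    have hhead := fun v => hbounds head v (q v) (hround head v (hF v).2.1) (hq v)
    have himb : ∀ v, |(endDegree head (s \ F) v : ℤ) - endDegree tail (s \ F) v| ≤ 1 ∧
        (endDegree tail s v = endDegree head s v → endDegree tail F v = endDegree head F v) ∧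
        (endDegree tail F v ≠ endDegree head F v →
          endDegree tail (s \ F) v = endDegree head (s \ F) v) := by
      intro v
      have h1 := hsplit head v
      have h2 := hsplit tail v
      have h3 := hb v
      have h4 : |((K : ℤ) + 1) * ((endDegree head F v : ℤ) - endDegree tail F v) -
          ((endDegree head s v : ℤ) - endDegree tail s v)| < K + 1 := by
        have h := (hF v).2.2
        have h2 : |((K : ℝ) + 1) * ((endDegree head F v : ℝ) - endDegree tail F v) -
            ((endDegree head s v : ℝ) - endDegree tail s v)| < K + 1 := by
          have : ((K : ℝ) + 1) * ((endDegree head F v : ℝ) - endDegree tail F v) -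
              ((endDegree head s v : ℝ) - endDegree tail s v) =
              (K + 1) * (((endDegree head F v : ℝ) - endDegree tail F v) -
                1 / ((K : ℝ) + 1) * ((endDegree head s v : ℝ) - endDegree tail s v)) := by
            field_simp
          rw [this, abs_mul, abs_of_pos hK]
          nlinarith
        exact_mod_cast h2
      generalize endDegree head F v = a at *
      generalize endDegree tail F v = b at *
      generalize endDegree head s v = a' at *
      generalize endDegree tail s v = b' at *
      rw [abs_le] at h3
      rw [abs_lt] at h4
      have hk : (0 : ℤ) ≤ K := by positivity
      -- the imbalance of the class is zero or the whole imbalance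
      have h5 : (a : ℤ) - b = 0 ∨ (a : ℤ) - b = a' - b' := by
        have hd : (a' : ℤ) - b' = -1 ∨ (a' : ℤ) - b' = 0 ∨ (a' : ℤ) - b' = 1 := by omega
        have h6 : (a : ℤ) - b < 2 := by
          by_contra hlt
          nlinarith [not_lt.1 hlt]
        have h7 : -2 < (a : ℤ) - b := by
          by_contra hlt
          nlinarith [not_lt.1 hlt]
        have h8 : (a : ℤ) - b = -1 ∨ (a : ℤ) - b = 0 ∨ (a : ℤ) - b = 1 := by omega
        rcases hd with hd | hd | hd <;> rcases h8 with h8 | h8 | h8 <;>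
          first
          | exact Or.inl h8
          | exact Or.inr (h8.trans hd.symm)
          | (exfalso; rw [hd, h8] at h4; omega)
      rw [abs_le]
      omega
    obtain ⟨c, hc, hcv⟩ := ih (s \ F) (fun v => (htail v).2.2) (fun v => (hhead v).2.2)
      fun v => (himb v).1
    have hlast : {e ∈ s | (if e ∈ F then K else c e) = K} = F := by
      ext e
      simp only [mem_filter]
      by_cases he : e ∈ F
      · simp [he, hFs he]
      · simp only [he, if_false, iff_false, not_and]
        intro hes
        exact (hc e (mem_sdiff.2 ⟨hes, he⟩)).ne
    have hother : ∀ i < K, {e ∈ s | (if e ∈ F then K else c e) = i} = {e ∈ s \ F | c e = i} := by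
      intro i hi
      ext e
      simp only [mem_filter, mem_sdiff]
      by_cases he : e ∈ F
      · simp [he, hi.ne']
      · simp [he]
    refine ⟨fun e => if e ∈ F then K else c e, fun e he => ?_, fun v => ⟨?_, ?_, ?_⟩⟩
    · show (if e ∈ F then K else c e) < K + 1
      split_ifs with h
      · exact Nat.lt_succ_self K
      · exact (hc e (mem_sdiff.2 ⟨he, h⟩)).trans (Nat.lt_succ_self K)
    · intro i hi
      rcases Nat.lt_succ_iff_lt_or_eq.1 hi with h | rfl
      · rw [hother i h]
        exact (hcv v).1 i h
      · rw [hlast]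
        exact ⟨(htail v).1, (htail v).2.1, (hhead v).1, (hhead v).2.1⟩
    · intro heq i hi
      have h6 := (himb v).2.1 heq
      rcases Nat.lt_succ_iff_lt_or_eq.1 hi with h | rfl
      · rw [hother i h]
        refine (hcv v).2.1 ?_ i h
        have := hsplit tail v
        have := hsplit head v
        omega
      · rw [hlast]
        exact h6
    · intro i hi j hj
      rcases Nat.lt_succ_iff_lt_or_eq.1 hi with h | rfl <;>
        rcases Nat.lt_succ_iff_lt_or_eq.1 hj with h' | rfl
      · rw [hother i h, hother j h']
        exact (hcv v).2.2 i h j h'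
      · rw [hother i h, hlast]
        intro h6 h7
        exact absurd ((hcv v).2.1 ((himb v).2.2 h7) i h) h6
      · rw [hother j h', hlast]
        intro h6 h7
        exact absurd ((hcv v).2.1 ((himb v).2.2 h6) j h') h7
      · exact fun _ _ => rfl

/-- **Evenly equitable colourings**: the edges of a finite graph can be coloured with `K` colours so
that the colour degrees at `v` lie in `[2q, 2q + 2]`, where `q = ⌊d(v) / 2K⌋`, and at most one of
them is odd. -/
theorem exists_colouring (φ : E × Bool → V) (s : Finset E) (K : ℕ) (hK : 0 < K) :
    ∃ c : E → ℕ, (∀ e ∈ s, c e < K) ∧ ∀ v,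
      (∀ i < K, 2 * (halfDegree φ s v / (2 * K)) ≤ halfDegree φ {e ∈ s | c e = i} v ∧
        halfDegree φ {e ∈ s | c e = i} v ≤ 2 * (halfDegree φ s v / (2 * K)) + 2) ∧
      (∀ i < K, ∀ j < K, Odd (halfDegree φ {e ∈ s | c e = i} v) →
        Odd (halfDegree φ {e ∈ s | c e = j} v) → i = j) := by
  classical
  obtain ⟨o, ho⟩ := exists_balanced_orientation_on φ s
  set Q : V → ℕ := fun v => halfDegree φ s v / (2 * K) with hQ
  -- the quotient for the degree also serves for the out-degree and the in-degree
  have hbd : ∀ v, (K * Q v ≤ endDegree (fun e => φ (e, o e)) s v ∧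
      endDegree (fun e => φ (e, o e)) s v ≤ K * (Q v + 1)) ∧
      (K * Q v ≤ endDegree (fun e => φ (e, !o e)) s v ∧
      endDegree (fun e => φ (e, !o e)) s v ≤ K * (Q v + 1)) := by
    intro v
    have h1 : 2 * K * Q v ≤ _ := Nat.mul_div_le (halfDegree φ s v) (2 * K)
    have h2 : _ < 2 * K * (Q v + 1) := Nat.lt_mul_div_succ (halfDegree φ s v) (by omega)
    rw [← halfDegree_orient φ o s v, mul_assoc] at h1 h2
    have h3 := abs_le.1 (ho v)
    omega
  obtain ⟨c, hc, hcv⟩ := exists_arc_colouring (fun e => φ (e, o e)) (fun e => φ (e, !o e)) K s Q Q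
    (fun v => (hbd v).1) (fun v => (hbd v).2) ho
  refine ⟨c, hc, fun v => ⟨fun i hi => ?_, fun i hi j hj hoi hoj => ?_⟩⟩
  · obtain ⟨h1, h2, h3, h4⟩ := (hcv v).1 i hi
    rw [← halfDegree_orient φ o {e ∈ s | c e = i}]
    simp only [hQ] at h1 h2 h3 h4
    omega
  · refine (hcv v).2.2 i hi j hj (fun h => ?_) (fun h => ?_)
    · rw [← halfDegree_orient φ o, h] at hoi
      exact (Nat.not_odd_iff_even.2 ⟨_, rfl⟩) hoi
    · rw [← halfDegree_orient φ o, h] at hoj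
      exact (Nat.not_odd_iff_even.2 ⟨_, rfl⟩) hoj

end Orientation

/-! ### Minimal Tutte violators -/

section Tutte

variable {N : Type*} {G : SimpleGraph N} {S C D : Set N}

/-- `C` is the vertex set of a connected component of `G - S`. Connectedness is encoded as an
induction principle: a set that meets `C` and is closed under adjacency in `C` contains `C`. -/
structure IsComp (G : SimpleGraph N) (S C : Set N) : Prop where
  nonempty : C.Nonempty
  notMem : ∀ a ∈ C, a ∉ S
  closed : ∀ a ∈ C, ∀ b ∉ S, G.Adj a b → b ∈ C
  connected : ∀ P : Set N, (C ∩ P).Nonempty →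
    (∀ a ∈ C, a ∈ P → ∀ b ∈ C, G.Adj a b → b ∈ P) → C ⊆ P

lemma IsComp.eq_of_mem (hC : IsComp G S C) (hD : IsComp G S D) {a : N} (h1 : a ∈ C) (h2 : a ∈ D) :
    C = D :=
  Set.Subset.antisymm
    (hC.connected D ⟨a, h1, h2⟩ fun x _ hx y hy h => hD.closed x hx y (hC.notMem y hy) h)
    (hD.connected C ⟨a, h2, h1⟩ fun x _ hx y hy h => hC.closed x hx y (hD.notMem y hy) h)

/-- Putting back a vertex without neighbours in a component leaves that component unchanged. -/
lemma IsComp.sdiff_singleton (hC : IsComp G S C) {s : N} (hs : ∀ a ∈ C, ¬G.Adj a s) :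
    IsComp G (S \ {s}) C where
  nonempty := hC.nonempty
  notMem a ha h := hC.notMem a ha h.1
  closed a ha b hb h := by
    refine hC.closed a ha b (fun hbS => hb ⟨hbS, ?_⟩) h
    rintro rfl
    exact hs a ha h
  connected := hC.connected

/-- The vertex `s` is adjacent to at least three components of `G - S`. -/
def MeetsThreeComps (G : SimpleGraph N) (S : Set N) (s : N) : Prop :=
  ∃ C₁ C₂ C₃ : Set N, C₁ ≠ C₂ ∧ C₁ ≠ C₃ ∧ C₂ ≠ C₃ ∧
    ∀ C ∈ ({C₁, C₂, C₃} : Set (Set N)), IsComp G S C ∧ ∃ y ∈ C, G.Adj s y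

lemma deleteVerts_adj {a b : ((⊤ : G.Subgraph).deleteVerts S).verts} :
    ((⊤ : G.Subgraph).deleteVerts S).coe.Adj a b ↔ G.Adj a b := by
  have ha := a.2
  have hb := b.2
  simp only [SimpleGraph.Subgraph.deleteVerts_verts, SimpleGraph.Subgraph.verts_top,
    Set.mem_sdiff, Set.mem_univ, true_and] at ha hb
  simp [ha, hb]

/-- The sets of odd size among the `IsComp G S` are the odd components of `G - S`. -/
lemma ncard_isComp_odd (G : SimpleGraph N) (S : Set N) :
    {C | IsComp G S C ∧ Odd C.ncard}.ncard =
      ((⊤ : G.Subgraph).deleteVerts S).coe.oddComponents.ncard := by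
  have hinj : Function.Injective
      fun c : ((⊤ : G.Subgraph).deleteVerts S).coe.ConnectedComponent =>
        (Subtype.val '' c.supp : Set N) :=
    fun c d h => SimpleGraph.ConnectedComponent.supp_injective
      (Set.image_injective.2 Subtype.val_injective h)
  rw [← Set.ncard_image_of_injective _ hinj]
  congr 1
  have hstep : ∀ (P : Set N) (a b : ((⊤ : G.Subgraph).deleteVerts S).verts),
      ((⊤ : G.Subgraph).deleteVerts S).coe.Reachable a b → a.1 ∈ P →
      (∀ x y : ((⊤ : G.Subgraph).deleteVerts S).verts,
        ((⊤ : G.Subgraph).deleteVerts S).coe.Reachable a y → x.1 ∈ P → G.Adj x y → y.1 ∈ P) →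
      b.1 ∈ P := by
    rintro P a b hab ha h
    rw [SimpleGraph.reachable_iff_reflTransGen] at hab
    induction hab with
    | refl => exact ha
    | tail h1 h2 ih =>
      exact h _ _ ((SimpleGraph.reachable_iff_reflTransGen _ _).2 (h1.tail h2)) ih
        (deleteVerts_adj.1 h2)
  have hverts : ∀ a : ((⊤ : G.Subgraph).deleteVerts S).verts, a.1 ∉ S := fun a => by
    simpa using a.2
  have hmk : ∀ a ∉ S, a ∈ ((⊤ : G.Subgraph).deleteVerts S).verts := fun a ha => by
    simpa using ha
  have hcomp : ∀ c : ((⊤ : G.Subgraph).deleteVerts S).coe.ConnectedComponent,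
      IsComp G S (Subtype.val '' c.supp) := by
    intro c
    refine ⟨c.nonempty_supp.image _, ?_, ?_, ?_⟩
    · rintro _ ⟨a, -, rfl⟩
      exact hverts a
    · rintro _ ⟨a, ha, rfl⟩ b hb hab
      refine ⟨⟨b, hmk b hb⟩, ?_, rfl⟩
      rw [SimpleGraph.ConnectedComponent.mem_supp_iff] at ha ⊢
      rw [← ha, SimpleGraph.ConnectedComponent.eq]
      exact (SimpleGraph.Adj.reachable (deleteVerts_adj.2 hab)).symm
    · rintro P ⟨_, ⟨a, ha, rfl⟩, haP⟩ hP _ ⟨b, hb, rfl⟩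
      rw [SimpleGraph.ConnectedComponent.mem_supp_iff] at ha hb
      refine hstep P a b (SimpleGraph.ConnectedComponent.exact (ha.trans hb.symm)) haP ?_
      intro x y hy hx hxy
      have hyc : y ∈ c.supp := by
        rw [SimpleGraph.ConnectedComponent.mem_supp_iff, ← ha, SimpleGraph.ConnectedComponent.eq]
        exact hy.symm
      refine hP x ⟨x, ?_, rfl⟩ hx y ⟨y, hyc, rfl⟩ hxy
      rw [SimpleGraph.ConnectedComponent.mem_supp_iff] at hyc ⊢
      rw [← hyc, SimpleGraph.ConnectedComponent.eq]
      exact SimpleGraph.Adj.reachable (deleteVerts_adj.2 hxy)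
  have hcard : ∀ c : ((⊤ : G.Subgraph).deleteVerts S).coe.ConnectedComponent,
      (Subtype.val '' c.supp : Set N).ncard = c.supp.ncard := fun c =>
    Set.ncard_image_of_injective _ Subtype.val_injective
  ext C
  constructor
  · rintro ⟨hC, hodd⟩
    obtain ⟨a, ha⟩ := hC.nonempty
    let c := ((⊤ : G.Subgraph).deleteVerts S).coe.connectedComponentMk
      ⟨a, hmk a (hC.notMem a ha)⟩
    have hCc : Subtype.val '' c.supp = C :=
      (hcomp c).eq_of_mem hC (a := a) ⟨⟨a, hmk a (hC.notMem a ha)⟩, rfl, rfl⟩ ha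
    refine ⟨c, ?_, hCc⟩
    show Odd c.supp.ncard
    rw [← hcard, hCc]
    exact hodd
  · rintro ⟨c, hc, rfl⟩
    exact ⟨hcomp c, by rw [hcard]; exact hc⟩

/-- Let `S` be a smallest set that violates Tutte's condition. By parity the violation is at least
two, so putting back a vertex of `S` must destroy at least three odd components. -/
theorem exists_violator [Finite N] (G : SimpleGraph N) (heven : Even (Nat.card N))
    (hG : ¬∃ m : N → N, ∀ x, G.Adj x (m x) ∧ m (m x) = x) :
    ∃ S : Set N, S.ncard < {C | IsComp G S C ∧ Odd C.ncard}.ncard ∧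
      ∀ s ∈ S, MeetsThreeComps G S s := by
  classical
  have hex : ∃ n, ∃ S : Set N, S.ncard = n ∧
      S.ncard < {C | IsComp G S C ∧ Odd C.ncard}.ncard := by
    by_contra hno
    apply hG
    have hT : ∃ M : G.Subgraph, M.IsPerfectMatching := by
      rw [SimpleGraph.tutte]
      intro S hS
      rw [SimpleGraph.IsTutteViolator, ← ncard_isComp_odd] at hS
      exact hno ⟨_, S, rfl, hS⟩
    obtain ⟨M, hM⟩ := hT
    have hM' : ∀ x, ∃ y, M.Adj x y ∧ ∀ z, M.Adj x z → z = y := fun x => by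
      obtain ⟨y, hy, hy'⟩ := hM.1 (hM.2 x)
      exact ⟨y, hy, hy'⟩
    choose m hm hm' using hM'
    exact ⟨m, fun x => ⟨(hm x).adj_sub, (hm' (m x) x (hm x).symm).symm⟩⟩
  obtain ⟨S, hSn, hS⟩ := Nat.find_spec hex
  refine ⟨S, hS, fun s hs => ?_⟩
  have hpar : Odd {C | IsComp G S C ∧ Odd C.ncard}.ncard ↔ Odd S.ncard := by
    rw [ncard_isComp_odd, SimpleGraph.odd_ncard_oddComponents, Nat.card_coe_set_eq]
    have h1 : ((⊤ : G.Subgraph).deleteVerts S).verts = Sᶜ := by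
      ext x; simp
    have h2 := Set.ncard_add_ncard_compl S
    rw [h1]
    rw [← h2] at heven
    rw [← Nat.not_even_iff_odd, ← Nat.not_even_iff_odd, (Nat.even_add.1 heven)]
  have hlt : (S \ {s}).ncard < S.ncard := Set.ncard_sdiff_singleton_lt_of_mem hs
  have hsmall : {C | IsComp G (S \ {s}) C ∧ Odd C.ncard}.ncard ≤ (S \ {s}).ncard := by
    by_contra hcon
    exact Nat.find_min hex (hSn ▸ hlt) ⟨_, rfl, not_le.1 hcon⟩
  set A : Set (Set N) := {C | (IsComp G S C ∧ Odd C.ncard) ∧ ∃ y ∈ C, G.Adj s y} with hA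
  have hsub : {C | IsComp G S C ∧ Odd C.ncard} ⊆
      A ∪ {C | IsComp G (S \ {s}) C ∧ Odd C.ncard} := by
    intro C hC
    by_cases h : ∃ y ∈ C, G.Adj s y
    · exact Or.inl ⟨hC, h⟩
    · exact Or.inr ⟨hC.1.sdiff_singleton fun a ha hadj => h ⟨a, ha, hadj.symm⟩, hC.2⟩
  have hcard := (Set.ncard_le_ncard hsub (Set.toFinite _)).trans (Set.ncard_union_le _ _)
  have h3 : 2 < A.ncard := by
    have h4 : S.ncard + 1 ≠ {C | IsComp G S C ∧ Odd C.ncard}.ncard := by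
      intro h5
      rw [← h5] at hpar
      rw [Nat.odd_add_one] at hpar
      tauto
    omega
  obtain ⟨C₁, C₂, C₃, h1, h2, h3, h12, h13, h23⟩ := (Set.two_lt_ncard_iff (Set.toFinite _)).1 h3
  refine ⟨C₁, C₂, C₃, h12, h13, h23, ?_⟩
  rintro C (rfl | rfl | rfl)
  exacts [⟨h1.1.1, h1.2⟩, ⟨h2.1.1, h2.2⟩, ⟨h3.1.1, h3.2⟩]

end Tutte

section Weights

open Classical in
/-- A fractional perfect matching `w` certifies the existence of a perfect matching as soon as it
puts weight at least one on the boundary of each odd component `C` of `G - S`. Only those sets `S`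
need to be considered of which each vertex is adjacent to three components. -/
theorem exists_matching_of_weights {N : Type*} [Fintype N] (G : SimpleGraph N)
    (heven : Even (Fintype.card N)) (w : N → N → ℝ) (hw0 : ∀ u s, 0 ≤ w u s)
    (hw1 : ∀ s, ∑ u, w u s ≤ 1)
    (hodd : ∀ S : Set N, (∀ s ∈ S, MeetsThreeComps G S s) → ∀ C, IsComp G S C → Odd C.ncard →
        1 ≤ ∑ u, if u ∈ C then ∑ s, (if s ∈ S then w u s else 0) else 0) :
    ∃ m : N → N, ∀ x, G.Adj x (m x) ∧ m (m x) = x := by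
  by_contra hno
  obtain ⟨S, hS, hthree⟩ := exists_violator G (by rwa [Nat.card_eq_fintype_card]) hno
  set O : Finset (Set N) := {C | IsComp G S C ∧ Odd C.ncard} with hO
  have hOS : S.ncard < #O := by
    have : {C | IsComp G S C ∧ Odd C.ncard} = (O : Set (Set N)) := by
      ext C; simp [hO]
    rwa [this, Set.ncard_coe_finset] at hS
  have h1 : (#O : ℝ) ≤ ∑ C ∈ O, ∑ u, if u ∈ C then ∑ s, (if s ∈ S then w u s else 0) else 0 := by
    rw [card_eq_sum_ones]
    push_cast
    refine sum_le_sum fun C hC => ?_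
    have hC' := (mem_filter.1 hC).2
    exact hodd S hthree C hC'.1 hC'.2
  have h2 : ∀ u, (∑ C ∈ O, if u ∈ C then ∑ s, (if s ∈ S then w u s else 0) else 0) ≤
      ∑ s, if s ∈ S then w u s else 0 := by
    intro u
    rw [← sum_filter, sum_const, nsmul_eq_mul]
    have h3 : #{C ∈ O | u ∈ C} ≤ 1 := by
      rw [card_le_one]
      intro C hC D hD
      rw [mem_filter, hO, mem_filter] at hC hD
      exact hC.1.2.1.eq_of_mem hD.1.2.1 hC.2 hD.2
    have h4 : (0 : ℝ) ≤ ∑ s, if s ∈ S then w u s else 0 :=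
      sum_nonneg fun s _ => by split_ifs; exacts [hw0 u s, le_rfl]
    have h5 : (#{C ∈ O | u ∈ C} : ℝ) ≤ 1 := by exact_mod_cast h3
    nlinarith
  have h3 : (∑ u, ∑ s, if s ∈ S then w u s else 0) ≤ S.ncard := by
    rw [sum_comm, Set.ncard_eq_toFinset_card', card_eq_sum_ones]
    push_cast
    rw [← sum_filter_add_sum_filter_not univ (· ∈ S),
      sum_eq_zero (s := {s | s ∉ S}), add_zero]
    · rw [show S.toFinset = ({s | s ∈ S} : Finset N) by ext; simp]
      refine sum_le_sum fun s hs => ?_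
      simp only [(mem_filter.1 hs).2, if_true]
      exact hw1 s
    · intro s hs
      simp [(mem_filter.1 hs).2]
  rw [sum_comm] at h1
  have h4 := (h1.trans (sum_le_sum fun u _ => h2 u)).trans h3
  have : #O ≤ S.ncard := by exact_mod_cast h4
  omega

/-- The neighbours of a single vertex `a` that is a component of `G - S` all lie in `S`, so the
boundary of this component carries the whole weight of `a`. -/
lemma weight_singleton {N : Type*} [Fintype N] {G : SimpleGraph N} {S : Set N} {a : N}
    [DecidablePred (· ∈ S)]
    (hC : IsComp G S {a}) (w : N → N → ℝ) (hw : ∀ u s, ¬G.Adj u s → w u s = 0) :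
    (∑ s, if s ∈ S then w a s else 0) = ∑ s, w a s := by
  refine sum_congr rfl fun s _ => ?_
  split_ifs with hs
  · rfl
  · refine (hw a s fun h => ?_).symm
    have := hC.closed a rfl s hs h
    rw [Set.mem_singleton_iff] at this
    exact h.ne this.symm

/-- A vertex `s` of `S` that is adjacent to three components of `G - S` has, whatever neighbour `p`
is left out, two other neighbours outside `S` in different components. -/
lemma false_of_neighbors {N : Type*} {G : SimpleGraph N} {S : Set N} {s : N} (p : N)
    (hs : MeetsThreeComps G S s)
    (h : ∀ y ∉ S, ∀ z ∉ S, G.Adj s y → G.Adj s z → y ≠ p → z ≠ p →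
      ∃ t ∉ S, G.Adj y t ∧ G.Adj z t) : False := by
  obtain ⟨C₁, C₂, C₃, h12, h13, h23, hC⟩ := hs
  obtain ⟨c1, y1, hy1, a1⟩ := hC C₁ (by simp)
  obtain ⟨c2, y2, hy2, a2⟩ := hC C₂ (by simp)
  obtain ⟨c3, y3, hy3, a3⟩ := hC C₃ (by simp)
  have key : ∀ {C D : Set N} {y z : N}, C ≠ D → IsComp G S C → IsComp G S D → y ∈ C → z ∈ D →
      G.Adj s y → G.Adj s z → y ≠ p → z ≠ p → False := by
    intro C D y z hCD hC hD hy hz hsy hsz hyp hzp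
    obtain ⟨t, ht, hyt, hzt⟩ := h y (hC.notMem y hy) z (hD.notMem z hz) hsy hsz hyp hzp
    exact hCD (hC.eq_of_mem hD (hC.closed y hy t ht hyt) (hD.closed z hz t ht hzt))
  by_cases e1 : y1 = p
  · have e2 : y2 ≠ p := fun e => h12 (c1.eq_of_mem c2 hy1 (e1 ▸ e ▸ hy2))
    have e3 : y3 ≠ p := fun e => h13 (c1.eq_of_mem c3 hy1 (e1 ▸ e ▸ hy3))
    exact key h23 c2 c3 hy2 hy3 a2 a3 e2 e3
  · by_cases e2 : y2 = p
    · have e3 : y3 ≠ p := fun e => h23 (c2.eq_of_mem c3 hy2 (e2 ▸ e ▸ hy3))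
      exact key h13 c1 c3 hy1 hy3 a1 a3 e1 e3
    · exact key h12 c1 c2 hy1 hy2 a1 a2 e1 e2

/-- A component that is contained in a pair and has odd size is a single vertex. -/
lemma eq_singleton_of_subset_pair {N : Type*} {C : Set N} {a b : N} (h : C ⊆ {a, b})
    (hodd : Odd C.ncard) : ∃ c, C = {c} := by
  rw [← Set.ncard_eq_one]
  have h1 := Set.ncard_le_ncard h (Set.toFinite _)
  have h2 := Set.ncard_insert_le a {b}
  rw [Set.ncard_singleton] at h2
  obtain ⟨k, hk⟩ := hodd
  omega

end Weights

/-! ### The matching gadget -/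

section Gadget

variable {V E κ : Type*}

/-- The other half of the edge to which the half-edge `h` belongs. -/
def partner (h : E × Bool) : E × Bool := (h.1, !h.2)

@[simp] lemma partner_partner (h : E × Bool) : partner (partner h) = h := by
  simp [partner]

lemma partner_ne (h : E × Bool) : partner h ≠ h := by
  obtain ⟨e, b⟩ := h
  cases b <;> simp [partner]

/-- The gadget whose perfect matchings encode factors. Its vertices are the half-edges and, for each
vertex `v` of the graph, core vertices `x` with `π x = v`. A half-edge is adjacent to its partner
and to the core of its end; two core vertices are adjacent if they are related by `Q`. An edge
belongs to the factor when its two halves are matched with each other. -/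
def gadget (φ : E × Bool → V) (π : κ → V) (Q : κ → κ → Prop) (hQs : ∀ x y, Q x y → Q y x)
    (hQi : ∀ x, ¬Q x x) : SimpleGraph ((E × Bool) ⊕ κ) where
  Adj
    | .inl h, .inl h' => h' = partner h
    | .inl h, .inr x => φ h = π x
    | .inr x, .inl h => φ h = π x
    | .inr x, .inr y => Q x y
  symm := ⟨by
    rintro (h | x) (h' | y) hab
    · subst hab
      exact (partner_partner h).symm
    · exact hab
    · exact hab
    · exact hQs _ _ hab⟩
  loopless := ⟨by
    rintro (h | x) hab
    · exact partner_ne h hab.symm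
    · exact hQi x hab⟩

open Classical in
/-- The number of edges with exactly one end in `A`. -/
noncomputable def cutCard [Fintype E] (φ : E × Bool → V) (A : Finset V) : ℕ :=
  #{h : E × Bool | φ h ∈ A ∧ φ (partner h) ∉ A}

end Gadget

section GadgetMatching

variable {V E κ : Type*} [Fintype V] [Fintype E] [Fintype κ] [DecidableEq V]
  {φ : E × Bool → V} {π : κ → V} {Q : κ → κ → Prop} {hQs : ∀ x y, Q x y → Q y x}
  {hQi : ∀ x, ¬Q x x} {S C : Set ((E × Bool) ⊕ κ)}

omit [Fintype V] [Fintype E] [Fintype κ] [DecidableEq V] in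
/-- The half-edges of a set that is invariant under passing to the partner come in pairs. -/
lemma even_card_of_partner [DecidableEq E] (s : Finset (E × Bool)) (hs : ∀ h ∈ s, partner h ∈ s) :
    Even #s := by
  have h1 : #{h ∈ s | h.2 = true} = #{h ∈ s | ¬h.2 = true} := by
    refine card_nbij' partner partner ?_ ?_ ?_ ?_
    · intro h hh
      simp only [coe_filter, Set.mem_ofPred_eq] at hh ⊢
      exact ⟨hs h hh.1, by simp [partner, hh.2]⟩
    · intro h hh
      simp only [coe_filter, Set.mem_ofPred_eq] at hh ⊢
      exact ⟨hs h hh.1, by simpa [partner] using hh.2⟩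
    · intro h _; exact partner_partner h
    · intro h _; exact partner_partner h
  rw [← card_filter_add_card_filter_not (s := s) (fun h => h.2 = true), ← h1]
  exact ⟨_, rfl⟩

/-- The component `C` consists of the gadgets of the vertices of `A` and the half-edges, with end in
`T`, of the edges between `T` and `A`. The edges that leave `A` end in `T` or have their outer half
in `S`. The vertices with property `T` are those whose core lies in `S`. -/
structure CompShape (φ : E × Bool → V) (π : κ → V) (S C : Set ((E × Bool) ⊕ κ)) (A : Finset V)
    (T : V → Prop) : Prop where
  half : ∀ h, Sum.inl h ∈ C ↔ φ h ∈ A ∨ T (φ h) ∧ φ (partner h) ∈ A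
  core : ∀ x, Sum.inr x ∈ C ↔ π x ∈ A
  core_mem : ∀ x, T (π x) → Sum.inr x ∈ S
  leave : ∀ h, φ h ∈ A → φ (partner h) ∈ A ∨ T (φ (partner h)) ∨
    Sum.inl (partner h) ∈ S
  notMem : ∀ v ∈ A, ¬T v

open Classical in
/-- If each vertex of `S` is adjacent to three components of `G - S`, then `S` contains all
half-edges at a vertex, or all of its core, or no vertex of its gadget, because a half-edge outside
`S` connects the core vertices outside `S`, and conversely. This determines the odd components that
are not single vertices. -/
lemma exists_compShape (hQπ : ∀ x y, Q x y → π x = π y) (hQu : ∀ x y z, Q x y → Q x z → y = z)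
    (hcore : ∀ h, ∃ x, π x = φ h) (hhalf : ∀ x, ∃ h, φ h = π x)
    (hS : ∀ s ∈ S, MeetsThreeComps (gadget φ π Q hQs hQi) S s)
    (hC : IsComp (gadget φ π Q hQs hQi) S C) (hodd : Odd C.ncard) (hns : ∀ a, C ≠ {a}) :
    ∃ A T, CompShape φ π S C A T := by
  set G := gadget φ π Q hQs hQi with hG
  have adj1 : ∀ h h', G.Adj (.inl h) (.inl h') ↔ h' = partner h := fun _ _ => Iff.rfl
  have adj2 : ∀ h x, G.Adj (.inl h) (.inr x) ↔ φ h = π x := fun _ _ => Iff.rfl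
  have adj3 : ∀ h x, G.Adj (.inr x) (.inl h) ↔ φ h = π x := fun _ _ => Iff.rfl
  have adj4 : ∀ x y, G.Adj (.inr x) (.inr y) ↔ Q x y := fun _ _ => Iff.rfl
  have allHalf : ∀ h, Sum.inl h ∈ S → ∀ h', φ h' = φ h → Sum.inl h' ∈ S := by
    intro h hh h' hh'
    by_contra hcon
    refine false_of_neighbors (.inl (partner h)) (hS _ hh) ?_
    rintro (y | y) - (z | z) - hy hz hyp hzp
    · exact absurd (congrArg Sum.inl ((adj1 _ _).1 hy)) hyp
    · exact absurd (congrArg Sum.inl ((adj1 _ _).1 hy)) hyp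
    · exact absurd (congrArg Sum.inl ((adj1 _ _).1 hz)) hzp
    · rw [adj2] at hy hz
      exact ⟨_, hcon, by rw [adj3, hh', hy], by rw [adj3, hh', hz]⟩
  have allCore : ∀ x, Sum.inr x ∈ S → ∀ y, π y = π x → Sum.inr y ∈ S := by
    intro x hx t ht
    by_contra hcon
    obtain ⟨p, hp⟩ : ∃ p, ∀ y, Q x y → y = p := by
      by_cases h : ∃ y, Q x y
      · obtain ⟨y, hy⟩ := h
        exact ⟨y, fun z hz => hQu _ _ _ hz hy⟩
      · exact ⟨x, fun y hy => absurd ⟨y, hy⟩ h⟩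
    refine false_of_neighbors (.inr p) (hS _ hx) ?_
    rintro (y | y) - (z | z) - hy hz hyp hzp
    · rw [adj3] at hy hz
      exact ⟨_, hcon, by rw [adj2, ht, hy], by rw [adj2, ht, hz]⟩
    · exact absurd (congrArg Sum.inr (hp _ ((adj4 _ _).1 hz))) hzp
    · exact absurd (congrArg Sum.inr (hp _ ((adj4 _ _).1 hy))) hyp
    · exact absurd (congrArg Sum.inr (hp _ ((adj4 _ _).1 hz))) hzp
  have notBoth : ∀ h x, φ h = π x → Sum.inl h ∈ S → Sum.inr x ∉ S := by
    intro h x hhx hh hx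
    refine false_of_neighbors (.inl (partner h)) (hS _ hh) ?_
    rintro (y | y) hyS z - hy - hyp -
    · exact absurd (congrArg Sum.inl ((adj1 _ _).1 hy)) hyp
    · rw [adj2] at hy
      exact absurd (allCore x hx y (hy.symm.trans hhx)) hyS
  have notPair : ∀ a b, C ⊆ {a, b} → False := fun a b h => by
    obtain ⟨c, hc⟩ := eq_singleton_of_subset_pair h hodd
    exact hns c hc
  let T : V → Prop := fun v => ∃ x, Sum.inr x ∈ S ∧ π x = v
  let U : V → Prop := fun v => ∃ h, Sum.inl h ∈ S ∧ φ h = v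
  have hTS : ∀ x, T (π x) → Sum.inr x ∈ S := by
    rintro x ⟨y, hy, hyx⟩
    exact allCore y hy x hyx.symm
  have hUS : ∀ h, U (φ h) → Sum.inl h ∈ S := by
    rintro h ⟨h', hh, hh'⟩
    exact allHalf h' hh h hh'.symm
  have hTU : ∀ v, T v → ¬U v := by
    rintro v ⟨x, hx, rfl⟩ ⟨h, hh, hhx⟩
    exact notBoth h x hhx hh hx
  have coreC : ∀ x, Sum.inr x ∈ C → ¬T (π x) ∧ ¬U (π x) := by
    intro x hx
    refine ⟨fun h => hC.notMem _ hx (hTS x h), fun hU => ?_⟩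
    -- otherwise `x` is a component together with the core vertex related to it, if there is one
    obtain ⟨p, hp⟩ : ∃ p, ∀ y, Q x y → y = p := by
      by_cases h : ∃ y, Q x y
      · obtain ⟨y, hy⟩ := h
        exact ⟨y, fun z hz => hQu _ _ _ hz hy⟩
      · exact ⟨x, fun y hy => absurd ⟨y, hy⟩ h⟩
    have hmem : ∀ y, π y = π x → ∀ b ∈ C, G.Adj (.inr y) b → ∃ z, b = .inr z ∧ Q y z := by
      rintro y hyx (h | z) hb hab
      · rw [adj3] at hab
        exact absurd (hUS h (by rw [hab, hyx]; exact hU)) (hC.notMem _ hb)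
      · exact ⟨z, rfl, hab⟩
    refine notPair (.inr x) (.inr p) (hC.connected _ ⟨_, hx, by simp⟩ ?_)
    rintro a ha (rfl | h) b hb hab
    · obtain ⟨z, rfl, hz⟩ := hmem x rfl b hb hab
      rw [hp z hz]
      simp
    · rw [Set.mem_singleton_iff] at h
      subst h
      by_cases hxp : Q x p
      · obtain ⟨z, rfl, hz⟩ := hmem p (hQπ _ _ hxp).symm b hb hab
        rw [hQu p z x hz (hQs _ _ hxp)]
        simp
      · by_cases hpx : p = x
        · subst hpx
          obtain ⟨z, rfl, hz⟩ := hmem p rfl b hb hab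
          rw [hp z hz]
          simp
        · exfalso
          -- nothing is related to `x`, so `x` is isolated
          refine hns (.inr x) (Set.Subset.antisymm (hC.connected _ ⟨_, hx, rfl⟩ ?_)
            (Set.singleton_subset_iff.2 hx))
          rintro _ - rfl c hc hxc
          obtain ⟨z, rfl, hz⟩ := hmem x rfl c hc hxc
          exact absurd (hp z hz ▸ hz) hxp
  have halfC : ∀ h, Sum.inl h ∈ C → T (φ h) → Sum.inl (partner h) ∈ C ∧ ¬T (φ (partner h)) ∧
      ¬U (φ (partner h)) := by
    intro h hh hT
    have hmem : ∀ g, T (φ g) → ∀ b ∈ C, G.Adj (.inl g) b → b = .inl (partner g) := by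
      rintro g hg (b | z) hb hab
      · exact congrArg _ ((adj1 _ _).1 hab)
      · rw [adj2] at hab
        exact absurd (hTS z (hab ▸ hg)) (hC.notMem _ hb)
    have hpC : Sum.inl (partner h) ∈ C := by
      by_contra hcon
      refine hns (.inl h) (Set.Subset.antisymm (hC.connected _ ⟨_, hh, rfl⟩ ?_)
        (Set.singleton_subset_iff.2 hh))
      rintro _ - rfl c hc hxc
      rw [hmem h hT c hc hxc] at hc
      exact absurd hc hcon
    refine ⟨hpC, fun hT' => ?_, fun hU => hC.notMem _ hpC (hUS _ hU)⟩
    refine notPair (.inl h) (.inl (partner h)) (hC.connected _ ⟨_, hh, by simp⟩ ?_)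
    rintro a - (rfl | h) b hb hab
    · rw [hmem h hT b hb hab]
      simp
    · rw [Set.mem_singleton_iff] at h
      subst h
      rw [hmem _ hT' b hb hab]
      simp
  let A : Finset V := {v | (¬T v ∧ ¬U v) ∧ ∃ h, Sum.inl h ∈ C ∧ φ h = v}
  have hA : ∀ v, v ∈ A ↔ (¬T v ∧ ¬U v) ∧ ∃ h, Sum.inl h ∈ C ∧ φ h = v := fun v => by
    simp [A]
  have hTn : ∀ x, ¬T (π x) → Sum.inr x ∉ S := fun x h hx => h ⟨x, hx, rfl⟩
  have hUn : ∀ h, ¬U (φ h) → Sum.inl h ∉ S := fun h hh hx => hh ⟨h, hx, rfl⟩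
  have coreA : ∀ x, π x ∈ A → Sum.inr x ∈ C := by
    intro x hx
    obtain ⟨⟨hT, hU⟩, h, hh, hhx⟩ := (hA _).1 hx
    exact hC.closed _ hh _ (hTn x hT) ((adj2 _ _).2 hhx)
  have halfA : ∀ h, φ h ∈ A → Sum.inl h ∈ C := by
    intro h hh
    obtain ⟨x, hx⟩ := hcore h
    have hU := ((hA _).1 hh).1.2
    exact hC.closed _ (coreA x (hx ▸ hh)) _ (hUn h hU) ((adj3 _ _).2 hx.symm)
  have hUC : ∀ h, Sum.inl h ∈ C → ¬U (φ h) := fun h hh hU => hC.notMem _ hh (hUS h hU)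
  refine ⟨A, T, fun h => ⟨fun hh => ?_, ?_⟩, fun x => ⟨fun hx => ?_, coreA x⟩, hTS, fun h hh => ?_,
    fun v hv => ((hA v).1 hv).1.1⟩
  · by_cases hT : T (φ h)
    · obtain ⟨h1, h2⟩ := halfC h hh hT
      exact Or.inr ⟨hT, (hA _).2 ⟨h2, _, h1, rfl⟩⟩
    · exact Or.inl ((hA _).2 ⟨⟨hT, hUC h hh⟩, h, hh, rfl⟩)
  · rintro (hh | ⟨hT, hh⟩)
    · exact halfA h hh
    · exact hC.closed _ (halfA _ hh) _ (hUn h (hTU _ hT))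
        ((adj1 _ _).2 (partner_partner h).symm)
  · obtain ⟨h, hh⟩ := hhalf x
    have h1 := coreC x hx
    rw [hA]
    refine ⟨h1, h, ?_, hh⟩
    exact hC.closed _ hx _ (hUn h (hh ▸ h1.2)) ((adj3 _ _).2 hh)
  · by_cases hU : Sum.inl (partner h) ∈ S
    · exact Or.inr (Or.inr hU)
    · by_cases hT : T (φ (partner h))
      · exact Or.inr (Or.inl hT)
      · refine Or.inl ((hA _).2 ⟨⟨hT, fun h' => hU (hUS _ h')⟩, partner h, ?_, rfl⟩)
        exact hC.closed _ (halfA h hh) _ hU ((adj1 _ _).2 rfl)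

omit [Fintype V] in
open Classical in
/-- The parity of a component of this shape: the number of edges from `A` to `S` is odd. -/
lemma CompShape.odd_card {A : Finset V} {T : V → Prop} (h : CompShape φ π S C A T)
    (hceven : ∀ v, Even #{x | π x = v}) (hodd : Odd C.ncard) :
    Odd #{g : E × Bool | φ g ∈ A ∧ φ (partner g) ∉ A ∧ ¬T (φ (partner g))} := by
  have hC : C.ncard = #{g : E × Bool | Sum.inl g ∈ C} + #{x : κ | Sum.inr x ∈ C} := by
    rw [Set.ncard_eq_toFinset_card', show C.toFinset = ({n | n ∈ C} : Finset _) by ext; simp,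
      card_filter, card_filter, card_filter, Fintype.sum_sum_type]
  have h1 : #{g : E × Bool | Sum.inl g ∈ C} = #{g : E × Bool | φ g ∈ A} +
      #{g : E × Bool | T (φ g) ∧ φ (partner g) ∈ A} := by
    rw [← card_union_of_disjoint]
    · congr 1
      ext g
      simp [h.half g]
    · rw [disjoint_filter]
      rintro g - hg ⟨hT, -⟩
      exact h.notMem _ hg hT
  have h2 : #{g : E × Bool | φ g ∈ A} = #{g : E × Bool | φ g ∈ A ∧ φ (partner g) ∈ A} +
      (#{g : E × Bool | φ g ∈ A ∧ T (φ (partner g))} +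
      #{g : E × Bool | φ g ∈ A ∧ φ (partner g) ∉ A ∧ ¬T (φ (partner g))}) := by
    rw [← card_union_of_disjoint, ← card_union_of_disjoint]
    · congr 1
      ext g
      simp only [mem_filter, mem_univ, true_and, mem_union]
      tauto
    · rw [disjoint_left]
      intro g
      simp only [mem_filter, mem_univ, true_and, mem_union]
      have := h.notMem (φ (partner g))
      tauto
    · rw [disjoint_left]
      intro g
      simp only [mem_filter, mem_univ, true_and]
      tauto
  have h3 : #{g : E × Bool | T (φ g) ∧ φ (partner g) ∈ A} =
      #{g : E × Bool | φ g ∈ A ∧ T (φ (partner g))} := by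
    refine card_nbij' partner partner ?_ ?_ ?_ ?_
    · intro g; simp; tauto
    · intro g; simp; tauto
    · intro g _; exact partner_partner g
    · intro g _; exact partner_partner g
  have h4 : Even #{g : E × Bool | φ g ∈ A ∧ φ (partner g) ∈ A} := by
    apply even_card_of_partner
    intro g
    simp; tauto
  have h5 : Even #{x : κ | Sum.inr x ∈ C} := by
    have : #{x : κ | Sum.inr x ∈ C} = ∑ v ∈ A, #{x | π x = v} := by
      rw [card_eq_sum_card_fiberwise (f := π) (t := A)]
      · refine sum_congr rfl fun v hv => ?_
        congr 1
        ext x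
        simp only [mem_filter, mem_univ, true_and, h.core x]
        constructor
        · exact fun h => h.2
        · rintro rfl; exact ⟨hv, rfl⟩
      · intro x hx
        simpa [h.core x] using hx
    rw [this]
    exact even_sum _ fun v _ => hceven v
  rw [hC, h1, h2, h3] at hodd
  obtain ⟨a, ha⟩ := h4
  obtain ⟨b, hb⟩ := h5
  rw [Nat.odd_iff] at hodd ⊢
  omega

open Classical in
/-- The fractional perfect matching of the gadget: weight `ε` on the pairs of partners, the weight
`μ x` of a core vertex spread evenly over the half-edges at its vertex, and the rest on the pairs of
related core vertices. -/
noncomputable def gadgetWeight (φ : E × Bool → V) (π : κ → V) (Q : κ → κ → Prop) (ε : ℝ)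
    (μ : κ → ℝ) : (E × Bool) ⊕ κ → (E × Bool) ⊕ κ → ℝ
  | .inl h, .inl h' => if h' = partner h then ε else 0
  | .inl h, .inr x => if φ h = π x then μ x / #{g | φ g = π x} else 0
  | .inr x, .inl h => if φ h = π x then μ x / #{g | φ g = π x} else 0
  | .inr x, .inr y => if Q x y then 1 - μ x else 0

open Classical in
/-- The gadget has a perfect matching if `ε` times the size of each odd cut is at least one. -/
theorem exists_gadget_matching (hQπ : ∀ x y, Q x y → π x = π y)
    (hQu : ∀ x y z, Q x y → Q x z → y = z)
    (hcore : ∀ h, ∃ x, π x = φ h) (hhalf : ∀ x, ∃ h, φ h = π x)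
    (hceven : ∀ v, Even #{x | π x = v}) (ε : ℝ) (hε0 : 0 ≤ ε) (hε1 : ε ≤ 1)
    (μ : κ → ℝ) (hμ0 : ∀ x, 0 ≤ μ x) (hμ1 : ∀ x, μ x ≤ 1)
    (hμQ : ∀ x, (∀ y, ¬Q x y) → μ x = 1) (hμs : ∀ x y, Q x y → μ x = μ y)
    (hμ : ∀ v, ∑ x with π x = v, μ x = (1 - ε) * #{h | φ h = v})
    (hconn : ∀ A : Finset V, Odd (cutCard φ A) → 1 ≤ ε * cutCard φ A) :
    ∃ m : (E × Bool) ⊕ κ → (E × Bool) ⊕ κ,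
      ∀ n, (gadget φ π Q hQs hQi).Adj n (m n) ∧ m (m n) = n := by
  set w := gadgetWeight φ π Q ε μ with hw
  have w1 : ∀ h h', w (.inl h) (.inl h') = if h' = partner h then ε else 0 := fun _ _ => rfl
  have w2 : ∀ h x, w (.inl h) (.inr x) =
    if φ h = π x then μ x / #{g | φ g = π x} else 0 := fun _ _ => rfl
  have w3 : ∀ h x, w (.inr x) (.inl h) =
    if φ h = π x then μ x / #{g | φ g = π x} else 0 := fun _ _ => rfl
  have w4 : ∀ x y, w (.inr x) (.inr y) = if Q x y then 1 - μ x else 0 := fun _ _ => rfl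
  have hw0 : ∀ u s, 0 ≤ w u s := by
    rintro (h | x) (h' | y)
    · rw [w1]; split_ifs; exacts [hε0, le_rfl]
    · rw [w2]; split_ifs; exacts [div_nonneg (hμ0 _) (by positivity), le_rfl]
    · rw [w3]; split_ifs; exacts [div_nonneg (hμ0 _) (by positivity), le_rfl]
    · rw [w4]; split_ifs; exacts [by linarith [hμ1 x], le_rfl]
  have hpos : ∀ h, (0 : ℝ) < #{g | φ g = φ h} := fun h => by
    exact_mod_cast card_pos.2 ⟨h, by simp⟩
  have hcoreSum : ∀ h, ∑ x, w (.inl h) (.inr x) = 1 - ε := by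
    intro h
    simp only [w2]
    rw [← sum_filter, sum_congr rfl (g := fun x => μ x / #{g | φ g = φ h})]
    · rw [← sum_div, sum_congr (s₂ := {x | π x = φ h}) (by ext; simp [eq_comm]) fun _ _ => rfl, hμ]
      field_simp [(hpos h).ne']
    · intro x hx
      rw [(mem_filter.1 hx).2]
  have hrow : ∀ u, ∑ s, w u s = 1 := by
    rintro (h | x)
    · rw [Fintype.sum_sum_type, hcoreSum]
      simp [w1]
    · rw [Fintype.sum_sum_type]
      obtain ⟨h, hh⟩ := hhalf x
      have e1 : ∑ g, w (.inr x) (.inl g) = μ x := by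
        simp only [w3]
        rw [← sum_filter, sum_const, nsmul_eq_mul]
        have := (hpos h).ne'
        rw [hh] at this
        field_simp
      have e2 : ∑ y, w (.inr x) (.inr y) = 1 - μ x := by
        simp only [w4]
        by_cases hx : ∃ y, Q x y
        · obtain ⟨y, hy⟩ := hx
          rw [sum_eq_single y]
          · simp [hy]
          · intro z _ hz
            rw [if_neg fun h => hz (hQu _ _ _ h hy)]
          · simp
        · rw [hμQ x fun y hy => hx ⟨y, hy⟩]
          simp
      rw [e1, e2]
      ring
  have hsymm : ∀ u s, w u s = w s u := by
    rintro (h | x) (h' | y)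
    · rw [w1, w1]
      congr 1
      exact propext ⟨fun h => by rw [h, partner_partner], fun h => by rw [h, partner_partner]⟩
    · rw [w2, w3]
    · rw [w2, w3]
    · rw [w4, w4]
      by_cases h : Q x y
      · rw [if_pos h, if_pos (hQs _ _ h), hμs x y h]
      · rw [if_neg h, if_neg fun h' => h (hQs _ _ h')]
  have hcard : Even (Fintype.card ((E × Bool) ⊕ κ)) := by
    rw [Fintype.card_sum, Fintype.card_prod, Fintype.card_bool]
    refine (even_two.mul_left _).add ?_
    rw [← card_univ, card_eq_sum_card_fiberwise (f := π) (t := univ) fun _ _ => mem_univ _]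
    exact even_sum _ fun v _ => hceven v
  refine exists_matching_of_weights _ hcard w hw0 (fun s => ?_) fun S hS C hC hodd => ?_
  · simp only [hsymm _ s]
    exact (hrow s).le
  · have hwadj : ∀ u s, ¬(gadget φ π Q hQs hQi).Adj u s → w u s = 0 := by
      rintro (h | x) (h' | y) hn
      · exact (w1 _ _).trans (if_neg hn)
      · exact (w2 _ _).trans (if_neg hn)
      · exact (w3 _ _).trans (if_neg hn)
      · exact (w4 _ _).trans (if_neg hn)
    have hterm : ∀ u, 0 ≤ if u ∈ C then ∑ s, (if s ∈ S then w u s else 0) else 0 := fun u => by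
      split_ifs
      · exact sum_nonneg fun s _ => by split_ifs; exacts [hw0 _ _, le_rfl]
      · exact le_rfl
    by_cases hns : ∃ a, C = {a}
    · obtain ⟨a, rfl⟩ := hns
      refine le_trans ?_ (single_le_sum (fun u _ => hterm u) (mem_univ a))
      rw [if_pos (Set.mem_singleton a), weight_singleton hC w hwadj, hrow]
    · obtain ⟨A, T, hsh⟩ := exists_compShape hQπ hQu hcore hhalf hS hC hodd
        fun a ha => hns ⟨a, ha⟩
      have hX := hsh.odd_card hceven hodd
      set X : Finset (E × Bool) := {g | φ g ∈ A ∧ φ (partner g) ∉ A ∧ ¬T (φ (partner g))} with hXd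
      set Y : Finset (E × Bool) := {g | T (φ g) ∧ φ (partner g) ∈ A} with hYd
      have hcut : cutCard φ A = #X + #Y := by
        have h3 : #Y = #{g : E × Bool | φ g ∈ A ∧ T (φ (partner g))} := by
          refine card_nbij' partner partner ?_ ?_ ?_ ?_
          · intro g; simp [hYd]; tauto
          · intro g; simp [hYd]; tauto
          · intro g _; exact partner_partner g
          · intro g _; exact partner_partner g
        rw [h3, ← card_union_of_disjoint, cutCard]
        · congr 1
          ext g
          have := hsh.notMem (φ (partner g))
          simp only [hXd, mem_filter, mem_univ, true_and, mem_union]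
          tauto
        · rw [disjoint_left]
          intro g
          simp only [hXd, mem_filter, mem_univ, true_and]
          tauto
      -- the boundary of `C` carries `ε` on each edge from `A` to `S`, `1 - ε` on each edge to `T`
      have hlow : ε * #X + (1 - ε) * #Y ≤
          ∑ u, if u ∈ C then ∑ s, (if s ∈ S then w u s else 0) else 0 := by
        rw [Fintype.sum_sum_type]
        refine le_trans ?_ (le_add_of_nonneg_right (sum_nonneg fun x _ => hterm _))
        have e1 : ε * #X + (1 - ε) * #Y =
            ∑ g : E × Bool, ((if g ∈ X then ε else 0) + if g ∈ Y then 1 - ε else 0) := by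
          rw [sum_add_distrib, ← sum_filter, ← sum_filter, sum_const, sum_const, nsmul_eq_mul,
            nsmul_eq_mul, filter_mem_eq_inter, filter_mem_eq_inter, univ_inter, univ_inter]
          ring
        rw [e1]
        refine sum_le_sum fun g _ => ?_
        by_cases hgX : g ∈ X
        · have hg := (mem_filter.1 hgX).2
          have hgY : g ∉ Y := fun h => hsh.notMem _ hg.1 (mem_filter.1 h).2.1
          rw [if_pos hgX, if_neg hgY, add_zero, if_pos ((hsh.half g).2 (Or.inl hg.1))]
          have hS' : Sum.inl (partner g) ∈ S := by
            rcases hsh.leave g hg.1 with h | h | h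
            exacts [absurd h hg.2.1, absurd h hg.2.2, h]
          refine le_trans ?_ (single_le_sum (f := fun s => if s ∈ S then w (.inl g) s else 0)
            (fun s _ => by split_ifs; exacts [hw0 _ _, le_rfl])
            (mem_univ (Sum.inl (partner g))))
          rw [if_pos hS', w1, if_pos rfl]
        · by_cases hgY : g ∈ Y
          · have hg := (mem_filter.1 hgY).2
            rw [if_neg hgX, if_pos hgY, zero_add, if_pos ((hsh.half g).2 (Or.inr hg)),
              Fintype.sum_sum_type, ← hcoreSum g]
            refine le_trans (sum_le_sum fun x _ => ?_) (le_add_of_nonneg_left (sum_nonneg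
              fun s _ => by split_ifs; exacts [hw0 _ _, le_rfl]))
            by_cases hgx : φ g = π x
            · rw [if_pos (hsh.core_mem x (hgx ▸ hg.1))]
            · rw [w2, if_neg hgx]
              split_ifs <;> exact le_rfl
          · rw [if_neg hgX, if_neg hgY, add_zero]
            exact hterm _
      refine le_trans ?_ hlow
      have hX1 : (1 : ℝ) ≤ #X := by exact_mod_cast hX.pos
      rcases Nat.eq_zero_or_pos #Y with hY | hY
      · rw [hY, add_zero] at hcut
        rw [hY, Nat.cast_zero, mul_zero, add_zero, ← hcut]
        exact hconn A (hcut ▸ hX)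
      · have hY1 : (1 : ℝ) ≤ #Y := by exact_mod_cast hY
        nlinarith

end GadgetMatching

/-! ### Parity factors of odd-edge-connected graphs -/

section ParityFactor

variable {V E : Type*} [DecidableEq V]

lemma halfDegree_eq_card [Fintype E] [DecidableEq E] (φ : E × Bool → V) (s : Finset E) (v : V) :
    halfDegree φ s v = #{h : E × Bool | h.1 ∈ s ∧ φ h = v} := by
  have hf : ∀ f : E → V, endDegree f s v = #{e | e ∈ s ∧ f e = v} := fun f => by
    rw [endDegree]
    congr 1
    ext e
    simp
  rw [halfDegree, hf, hf, card_filter, card_filter, card_filter, Fintype.sum_prod_type,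
    ← sum_add_distrib]
  refine sum_congr rfl fun e _ => ?_
  rw [Fintype.sum_bool, add_comm]

variable [Fintype V] [Fintype E]

/-- If `1 / ε` is a lower bound for the odd cuts, then the fraction `ε` of the graph can be chosen
with the same degree parities as the graph. The core at `v` has `c v` vertices, where `c v` is the
least even number that is at least `(1 - ε) d(v)`, and unless this number is attained two of them
may be matched with each other. Thus the edges outside the factor number `c v` or `c v - 2` at
`v`. -/
theorem exists_parity_fraction (φ : E × Bool → V) (ε : ℝ) (hε0 : 0 ≤ ε) (hε1 : ε < 1)
    (hconn : ∀ A : Finset V, Odd (cutCard φ A) → 1 ≤ ε * cutCard φ A) :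
    ∃ F : Finset E, ∀ v, |(halfDegree φ F v : ℝ) - ε * halfDegree φ univ v| < 2 ∧
      (Even (halfDegree φ F v) ↔ Even (halfDegree φ univ v)) := by
  classical
  let d : V → ℕ := fun v => #{h | φ h = v}
  have hd : ∀ v, halfDegree φ univ v = d v := fun v => by
    rw [halfDegree_eq_card]
    simp [d]
  let c : V → ℕ := fun v => 2 * ⌈(1 - ε) * d v / 2⌉₊
  have hcEven : ∀ v, Even (c v) := fun v => even_two_mul _
  have hdn : ∀ v, 0 ≤ (1 - ε) * d v := fun v => mul_nonneg (by linarith) (by positivity)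
  have hc1 : ∀ v, (1 - ε) * d v ≤ c v := fun v => by
    have := Nat.le_ceil ((1 - ε) * d v / 2)
    simp only [c]
    push_cast
    linarith
  have hc2 : ∀ v, (c v : ℝ) < (1 - ε) * d v + 2 := fun v => by
    have := Nat.ceil_lt_add_one (a := (1 - ε) * d v / 2) (by linarith [hdn v])
    simp only [c]
    push_cast
    linarith
  let κ := Σ v, Fin (c v)
  let Q : κ → κ → Prop := fun x y => x.1 = y.1 ∧ (1 - ε) * d x.1 < c x.1 ∧
    x.2.val < 2 ∧ y.2.val < 2 ∧ x.2.val ≠ y.2.val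
  have hQs : ∀ x y, Q x y → Q y x := fun x y ⟨h1, h2, h3, h4, h5⟩ =>
    ⟨h1.symm, h1 ▸ h2, h4, h3, h5.symm⟩
  have hQi : ∀ x, ¬Q x x := fun x h => h.2.2.2.2 rfl
  have hQu : ∀ x y z, Q x y → Q x z → y = z := by
    rintro ⟨v, i⟩ ⟨v', j⟩ ⟨v'', k⟩ ⟨h1, -, h3, h4, h5⟩ ⟨h1', -, h3', h4', h5'⟩
    dsimp only at h1 h3 h4 h5 h1' h3' h4' h5'
    subst h1
    subst h1'
    have : j = k := by
      apply Fin.ext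
      omega
    rw [this]
  have hsum : ∀ (f : κ → ℝ) v, ∑ x with x.1 = v, f x = ∑ i : Fin (c v), f ⟨v, i⟩ := by
    intro f v
    rw [sum_filter, Fintype.sum_sigma, sum_eq_single v]
    · simp
    · intro u _ hu
      simp [hu]
    · simp
  have hfib : ∀ v, #{x : κ | x.1 = v} = c v := by
    intro v
    have := hsum (fun _ => 1) v
    simp only [sum_const, nsmul_eq_mul, mul_one, card_univ, Fintype.card_fin] at this
    exact_mod_cast this
  -- the two core vertices that may be matched with each other
  have hpair : ∀ v, (1 - ε) * d v < c v → #{i : Fin (c v) | i.val < 2} = 2 := by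
    intro v hv
    have h0 : (0 : ℝ) < c v := (hdn v).trans_lt hv
    have h1 : 0 < c v := by exact_mod_cast h0
    obtain ⟨k, hk⟩ := hcEven v
    rw [Fin.card_filter_val_lt]
    omega
  let μ : κ → ℝ := fun x => if (1 - ε) * d x.1 < c x.1 ∧ x.2.val < 2
    then 1 - (c x.1 - (1 - ε) * d x.1) / 2 else 1
  obtain ⟨m, hm⟩ := exists_gadget_matching (φ := φ) (π := Sigma.fst) (Q := Q) (hQs := hQs)
    (hQi := hQi) (fun x y h => h.1) hQu (fun h => by
      have h1 : (1 : ℝ) ≤ d (φ h) := by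
        exact_mod_cast card_pos.2 ⟨h, by simp⟩
      have h2 : (0 : ℝ) < c (φ h) := lt_of_lt_of_le (by nlinarith) (hc1 (φ h))
      exact ⟨⟨φ h, ⟨0, by exact_mod_cast h2⟩⟩, rfl⟩) (fun x => by
      by_contra hno
      have h1 : d x.1 = 0 := by
        rw [card_eq_zero, filter_eq_empty_iff]
        exact fun h _ hh => hno ⟨h, hh⟩
      have h2 : c x.1 = 0 := by simp [c, h1]
      exact absurd x.2.isLt (by omega)) (fun v => by rw [hfib]; exact hcEven v) ε hε0 hε1.le μ
    (fun x => by
      simp only [μ]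
      split_ifs
      · linarith [hc2 x.1]
      · exact zero_le_one) (fun x => by
      simp only [μ]
      split_ifs
      · linarith [hc1 x.1]
      · exact le_rfl) (fun x hx => by
      simp only [μ]
      refine if_neg ?_
      rintro ⟨h1, h2⟩
      have h0 : (0 : ℝ) < c x.1 := (hdn _).trans_lt h1
      have h3 : 0 < c x.1 := by exact_mod_cast h0
      have h4 : 2 ≤ c x.1 := by
        obtain ⟨k, hk⟩ := hcEven x.1
        omega
      exact hx ⟨x.1, ⟨1 - x.2.val, by omega⟩⟩ ⟨rfl, h1, h2, by dsimp only; omega, by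
        dsimp only; omega⟩) (fun x y h => by
      obtain ⟨h1, h2, h3, h4, -⟩ := h
      simp only [μ]
      rw [if_pos ⟨h2, h3⟩, if_pos ⟨h1 ▸ h2, h4⟩, h1]) (fun v => by
      rw [hsum]
      simp only [μ]
      by_cases hv : (1 - ε) * d v < c v
      · rw [sum_congr rfl (g := fun i : Fin (c v) =>
          1 - if i.val < 2 then (c v - (1 - ε) * d v) / 2 else 0) fun i _ => by
            by_cases hi : i.val < 2
            · rw [if_pos ⟨hv, hi⟩, if_pos hi]
            · rw [if_neg fun h => hi h.2, if_neg hi, sub_zero]]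
        rw [sum_sub_distrib, ← sum_filter, sum_const, sum_const, hpair v hv, card_univ,
          Fintype.card_fin, nsmul_eq_mul, nsmul_eq_mul]
        push_cast
        ring
      · simp only [hv, false_and, if_false]
        rw [sum_const, card_univ, Fintype.card_fin, nsmul_eq_mul, mul_one]
        exact le_antisymm (not_lt.1 hv) (hc1 v)) hconn
  set G := gadget φ (Sigma.fst : κ → V) Q hQs hQi with hG
  have adj1 : ∀ h h', G.Adj (.inl h) (.inl h') ↔ h' = partner h := fun _ _ => Iff.rfl
  have adj2 : ∀ h x, G.Adj (.inl h) (.inr x) ↔ φ h = x.1 := fun _ _ => Iff.rfl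
  have adj3 : ∀ h x, G.Adj (.inr x) (.inl h) ↔ φ h = x.1 := fun _ _ => Iff.rfl
  have adj4 : ∀ x y, G.Adj (.inr x) (.inr y) ↔ Q x y := fun _ _ => Iff.rfl
  let F : Finset E := {e | m (.inl (e, false)) = .inl (e, true)}
  have hF : ∀ h : E × Bool, h.1 ∈ F ↔ (m (.inl h)).isLeft := by
    have h1 : ∀ h : E × Bool, (m (.inl h)).isLeft ↔ m (.inl h) = .inl (partner h) := by
      intro h
      have hadj := (hm (.inl h)).1
      rcases hmh : m (.inl h) with g | x
      · rw [hmh, adj1] at hadj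
        simp [hadj]
      · simp
    have h2 : ∀ h : E × Bool, m (.inl h) = .inl (partner h) →
        m (.inl (partner h)) = .inl h := by
      intro h hh
      rw [← hh, (hm _).2]
    rintro ⟨e, b⟩
    rw [h1]
    simp only [F, mem_filter, mem_univ, true_and]
    cases b
    · rfl
    · exact ⟨fun h => h2 (e, false) h, fun h => h2 (e, true) h⟩
  refine ⟨F, fun v => ?_⟩
  have hmm : Function.Involutive m := fun n => (hm n).2
  -- half-edges matched into the core correspond to core vertices matched with half-edges
  have hcross : #{h : E × Bool | φ h = v ∧ (m (.inl h)).isRight} =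
      #{x : κ | x.1 = v ∧ (m (.inr x)).isLeft} := by
    have h1 : #{n : (E × Bool) ⊕ κ | (n.isLeft ∧ Sum.elim φ Sigma.fst n = v) ∧ (m n).isRight} =
        #{n : (E × Bool) ⊕ κ | (n.isRight ∧ Sum.elim φ Sigma.fst n = v) ∧ (m n).isLeft} := by
      refine card_nbij' m m ?_ ?_ (fun n _ => hmm n) (fun n _ => hmm n)
      · intro n hn
        simp only [coe_filter, mem_univ, true_and, Set.mem_ofPred_eq] at hn ⊢
        have hadj := (hm n).1
        rw [hmm]
        rcases n with h | x
        · rcases hmn : m (.inl h) with g | y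
          · rw [hmn] at hn; simp at hn
          · rw [hmn, adj2] at hadj
            simp only [Sum.elim_inl] at hn
            simp [← hadj, hn]
        · simp at hn
      · intro n hn
        simp only [coe_filter, mem_univ, true_and, Set.mem_ofPred_eq] at hn ⊢
        have hadj := (hm n).1
        rw [hmm]
        rcases n with h | x
        · simp at hn
        · rcases hmn : m (.inr x) with g | y
          · rw [hmn, adj3] at hadj
            simp only [Sum.elim_inr] at hn
            simp [hadj, hn]
          · rw [hmn] at hn; simp at hn
    rw [card_filter, card_filter, Fintype.sum_sum_type, Fintype.sum_sum_type] at h1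
    simp only [Sum.isLeft_inl, Sum.isLeft_inr, Sum.isRight_inl, Sum.isRight_inr, Sum.elim_inl,
      Sum.elim_inr, true_and, false_and, Bool.false_eq_true, if_false, sum_const_zero, add_zero,
      zero_add] at h1
    rwa [card_filter, card_filter]
  have hdeg : d v = halfDegree φ F v + #{h : E × Bool | φ h = v ∧ (m (.inl h)).isRight} := by
    rw [halfDegree_eq_card, ← card_union_of_disjoint]
    · refine congrArg card ?_
      ext h
      simp only [mem_filter, mem_univ, true_and, mem_union, hF]
      rcases m (.inl h) with g | x <;> simp
    · rw [disjoint_left]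
      intro h
      simp only [mem_filter, mem_univ, true_and, hF]
      rcases m (.inl h) with g | x <;> simp
  have hcoreCount : c v = #{x : κ | x.1 = v ∧ (m (.inr x)).isLeft} +
      #{x : κ | x.1 = v ∧ (m (.inr x)).isRight} := by
    rw [← hfib v, ← card_union_of_disjoint]
    · congr 1
      ext x
      simp only [mem_filter, mem_univ, true_and, mem_union]
      rcases m (.inr x) with g | y <;> simp
    · rw [disjoint_left]
      intro x
      simp only [mem_filter, mem_univ, true_and]
      rcases m (.inr x) with g | y <;> simp
  have hinner : #{x : κ | x.1 = v ∧ (m (.inr x)).isRight} = 0 ∨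
      #{x : κ | x.1 = v ∧ (m (.inr x)).isRight} = 2 ∧ (1 - ε) * d v < c v := by
    rcases Finset.eq_empty_or_nonempty {x : κ | x.1 = v ∧ (m (.inr x)).isRight} with h | ⟨x, hx⟩
    · exact Or.inl (by rw [h, card_empty])
    · right
      have hQm : ∀ x : κ, x.1 = v ∧ (m (.inr x)).isRight → ∃ y, m (.inr x) = .inr y ∧ Q x y := by
        rintro x ⟨-, hx⟩
        have hadj := (hm (.inr x)).1
        rcases hmx : m (.inr x) with g | y
        · rw [hmx] at hx; simp at hx
        · exact ⟨y, rfl, (adj4 _ _).1 (hmx ▸ hadj)⟩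
      have hx' := (mem_filter.1 hx).2
      obtain ⟨y, hy, hQ⟩ := hQm x hx'
      have hv : (1 - ε) * d v < c v := by
        rw [← hx'.1]
        exact hQ.2.1
      refine ⟨le_antisymm ?_ ?_, hv⟩
      · refine (card_le_card (t := map (Function.Embedding.sigmaMk v)
          {i : Fin (c v) | i.val < 2}) fun z hz => ?_).trans (by rw [card_map, hpair v hv])
        have hz' := (mem_filter.1 hz).2
        obtain ⟨u, -, hu⟩ := hQm z hz'
        obtain ⟨z1, z2⟩ := z
        obtain rfl : z1 = v := hz'.1
        exact mem_map.2 ⟨z2, by simpa using hu.2.2.1, rfl⟩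
      · refine one_lt_card.2 ⟨x, hx, y, ?_, fun h => hQi x (by rw [← h] at hQ; exact hQ)⟩
        have : m (.inr y) = .inr x := by rw [← hy, hmm]
        simp [this, ← hQ.1, hx'.1]
  rw [hd]
  rw [hcross] at hdeg
  have hE := hcEven v
  have b1 := hc1 v
  have b2 := hc2 v
  have hdR : (d v : ℝ) = halfDegree φ F v + #{x : κ | x.1 = v ∧ (m (.inr x)).isLeft} := by
    exact_mod_cast hdeg
  constructor
  · rcases hinner with h | ⟨h, hv⟩
    · rw [h, add_zero] at hcoreCount
      rw [← hcoreCount] at hdR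
      rw [abs_lt]
      constructor <;> linarith
    · rw [h] at hcoreCount
      have : (c v : ℝ) = #{x : κ | x.1 = v ∧ (m (.inr x)).isLeft} + 2 := by
        exact_mod_cast hcoreCount
      rw [abs_lt]
      constructor <;> linarith
  · rw [hdeg, Nat.even_add]
    have : Even #{x : κ | x.1 = v ∧ (m (.inr x)).isLeft} := by
      obtain ⟨k, hk⟩ := hE
      rw [Nat.even_iff]
      rcases hinner with h | ⟨h, -⟩ <;> omega
    tauto

end ParityFactor

/-! ### Completing a factor to a factorization -/

section Colouring

variable {V E : Type*} [DecidableEq V]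

lemma halfDegree_eq_sum_fiber (φ : E × Bool → V) (s : Finset E) (c : E → ℕ) (K : ℕ)
    (hc : ∀ e ∈ s, c e < K) (v : V) :
    halfDegree φ s v = ∑ i ∈ range K, halfDegree φ {e ∈ s | c e = i} v := by
  have h : ∀ f : E → V, endDegree f s v = ∑ i ∈ range K, endDegree f {e ∈ s | c e = i} v := by
    intro f
    rw [endDegree, card_eq_sum_card_fiberwise (f := c) (t := range K)]
    · refine sum_congr rfl fun i _ => ?_
      rw [endDegree, filter_comm]
    · intro e he
      have := hc e (mem_filter.1 he).1
      simpa using this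
  simp only [halfDegree, sum_add_distrib]
  rw [h, h]

/-- If `K` parts lie in `[2q, 2q + 2]` and their sum `R` is within two, not merely `2K`, of `K x`,
then each part is within two of `x`. -/
lemma abs_part_sub_lt {K : ℕ} (D : ℕ → ℕ) (q R : ℕ) (x : ℝ) (hR : R = ∑ i ∈ range K, D i)
    (hD : ∀ i < K, 2 * q ≤ D i ∧ D i ≤ 2 * q + 2) (hx : |(R : ℝ) - K * x| < 2) {i : ℕ}
    (hi : i < K) : |(D i : ℝ) - x| < 2 := by
  have hK : (1 : ℝ) ≤ K := by exact_mod_cast (Nat.zero_lt_of_lt hi)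
  have hcard : ((#((range K).erase i) : ℕ) : ℝ) = K - 1 := by
    rw [card_erase_of_mem (mem_range.2 hi), card_range, Nat.cast_sub (Nat.zero_lt_of_lt hi)]
    simp
  have hsplit : (R : ℝ) = D i + ∑ j ∈ (range K).erase i, (D j : ℝ) := by
    rw [add_sum_erase _ (fun j => (D j : ℝ)) (mem_range.2 hi), hR]
    push_cast
    rfl
  have hlow : ((K : ℝ) - 1) * (2 * q) ≤ ∑ j ∈ (range K).erase i, (D j : ℝ) := by
    rw [← hcard, ← nsmul_eq_mul]
    refine card_nsmul_le_sum _ _ _ fun j hj => ?_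
    exact_mod_cast (hD j (mem_range.1 (mem_of_mem_erase hj))).1
  have hupp : ∑ j ∈ (range K).erase i, (D j : ℝ) ≤ ((K : ℝ) - 1) * (2 * q + 2) := by
    rw [← hcard, ← nsmul_eq_mul]
    refine sum_le_card_nsmul _ _ _ fun j hj => ?_
    exact_mod_cast (hD j (mem_range.1 (mem_of_mem_erase hj))).2
  have h1 : (2 * q : ℝ) ≤ D i := by exact_mod_cast (hD i hi).1
  have h2 : (D i : ℝ) ≤ 2 * q + 2 := by exact_mod_cast (hD i hi).2
  rw [abs_lt] at hx ⊢
  constructor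
  · by_contra hcon
    nlinarith [not_lt.1 hcon]
  · by_contra hcon
    nlinarith [not_lt.1 hcon]

/-- If the sum of numbers of which at most one is odd is even, then none of them is odd. -/
lemma even_of_sum_even {K : ℕ} (D : ℕ → ℕ) (hsum : Even (∑ i ∈ range K, D i))
    (hD : ∀ i < K, ∀ j < K, Odd (D i) → Odd (D j) → i = j) {i : ℕ} (hi : i < K) : Even (D i) := by
  by_contra hodd
  rw [Nat.not_even_iff_odd] at hodd
  rw [← add_sum_erase _ _ (mem_range.2 hi)] at hsum
  have h2 : Even (∑ j ∈ (range K).erase i, D j) := even_sum _ fun j hj => by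
    by_contra hj'
    rw [Nat.not_even_iff_odd] at hj'
    exact (mem_erase.1 hj).1 (hD j (mem_range.1 (mem_erase.1 hj).2) i hi hj' hodd)
  exact (Nat.not_even_iff_odd.2 hodd) ((Nat.even_add.1 hsum).2 h2)

variable [Fintype V] [Fintype E] [DecidableEq E]

/-- A factor `F` with the right degrees, such that `d_F(v)` is even where `d(v)` is, can be
completed: colour the other edges evenly equitably. -/
theorem exists_completion (φ : E × Bool → V) {K : ℕ} (ε : Fin (K + 1) → ℝ) (hsum : ∑ i, ε i = 1)
    (heq : ∀ i j, i ≠ 0 → j ≠ 0 → ε i = ε j) (F : Finset E) (hF0 : K = 0 → F = univ)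
    (hF : ∀ v, |(halfDegree φ F v : ℝ) - ε 0 * halfDegree φ univ v| < 2 ∧
      (Even (halfDegree φ univ v) → Even (halfDegree φ F v))) :
    ∃ c : E → Fin (K + 1), ({e | c e = 0} : Finset E) = F ∧ ∀ v,
      (∀ i, |(halfDegree φ {e | c e = i} v : ℝ) - ε i * halfDegree φ univ v| < 2) ∧
      ∀ i j, Odd (halfDegree φ {e | c e = i} v) → Odd (halfDegree φ {e | c e = j} v) → i = j := by
  rcases Nat.eq_zero_or_pos K with rfl | hK
  · have h0 : ∀ i : Fin (0 + 1), ({e | (0 : Fin (0 + 1)) = i} : Finset E) = F := fun i => by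
      rw [hF0 rfl, Fin.fin_one_eq_zero i]
      simp
    refine ⟨fun _ => 0, h0 0, fun v => ⟨fun i => ?_, fun i j _ _ => Fin.ext (by omega)⟩⟩
    rw [h0, Fin.fin_one_eq_zero i]
    exact (hF v).1
  · obtain ⟨c, hc, hcv⟩ := exists_colouring φ Fᶜ K hK
    have hcE : ∀ e, e ∉ F → c e < K := fun e he => hc e (mem_compl.2 he)
    let C : E → Fin (K + 1) := fun e => if h : e ∈ F then 0 else Fin.succ ⟨c e, hcE e h⟩
    have hC0 : ({e | C e = 0} : Finset E) = F := by
      ext e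
      by_cases he : e ∈ F <;> simp [C, he]
    have hCs : ∀ i : Fin K, ({e | C e = i.succ} : Finset E) = {e ∈ Fᶜ | c e = i} := by
      intro i
      ext e
      by_cases he : e ∈ F
      · simp [C, he, (Fin.succ_ne_zero i).symm]
      · simp [C, he, Fin.ext_iff]
    have hδ : ∀ i : Fin K, ε i.succ = ε (Fin.succ ⟨0, hK⟩) := fun i =>
      heq _ _ (Fin.succ_ne_zero _) (Fin.succ_ne_zero _)
    set δ := ε (Fin.succ ⟨0, hK⟩) with hδd
    have hεδ : ε 0 + K * δ = 1 := by
      rw [Fin.sum_univ_succ, sum_congr rfl fun i _ => hδ i] at hsum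
      simpa using hsum
    have hdeg : ∀ v, halfDegree φ univ v = halfDegree φ F v + halfDegree φ Fᶜ v := fun v => by
      rw [← halfDegree_add_of_disjoint φ disjoint_compl_right, union_compl]
    refine ⟨C, hC0, fun v => ⟨fun i => ?_, ?_⟩⟩
    · cases i using Fin.cases with
      | zero => rw [hC0]; exact (hF v).1
      | succ i =>
        rw [hCs, hδ]
        refine abs_part_sub_lt _ _ _ _ (halfDegree_eq_sum_fiber φ Fᶜ c K hc v) (hcv v).1 ?_ i.isLt
        have h1 := (hF v).1
        have h2 : (halfDegree φ univ v : ℝ) = halfDegree φ F v + halfDegree φ Fᶜ v := by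
          exact_mod_cast hdeg v
        rw [← abs_neg] at h1
        convert h1 using 2
        have h3 : ε 0 = 1 - K * δ := by linarith
        rw [h3]
        linear_combination -h2
    · -- where `F` has odd degree, so has the graph, and all other degrees are even
      have hFodd : Odd (halfDegree φ F v) → ∀ i : Fin K,
          ¬Odd (halfDegree φ {e ∈ Fᶜ | c e = i} v) := by
        intro h i
        rw [Nat.not_odd_iff_even]
        refine even_of_sum_even _ ?_ (hcv v).2 i.isLt
        rw [← halfDegree_eq_sum_fiber φ Fᶜ c K hc v]
        have h1 : ¬Even (halfDegree φ univ v) := fun h1 =>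
          (Nat.not_even_iff_odd.2 h) ((hF v).2 h1)
        rw [hdeg v] at h1
        by_contra h2
        rw [Nat.not_even_iff_odd] at h2
        exact h1 (h.add_odd h2)
      intro i j
      cases i using Fin.cases with
      | zero =>
        cases j using Fin.cases with
        | zero => exact fun _ _ => rfl
        | succ j =>
          rw [hC0, hCs]
          exact fun h1 h2 => absurd h2 (hFodd h1 j)
      | succ i =>
        cases j using Fin.cases with
        | zero =>
          rw [hC0, hCs]
          exact fun h1 h2 => absurd h1 (hFodd h2 i)
        | succ j =>
          rw [hCs, hCs]
          exact fun h1 h2 => congrArg Fin.succ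
            (Fin.ext ((hcv v).2 i i.isLt j j.isLt h1 h2))

end Colouring

/-! ### Multigraphs and their half-edges -/

section Transfer

variable {α β : Type*} {G : Graph α β}

lemma exists_ends (G : Graph α β) : ∃ φ : G.edgeSet × Bool → G.vertexSet,
    ∀ e : G.edgeSet, G.IsLink e (φ (e, false)) (φ (e, true)) := by
  have h : ∀ e : G.edgeSet, ∃ x y : G.vertexSet, G.IsLink e x y := fun e => by
    obtain ⟨x, y, hxy⟩ := G.exists_isLink_of_mem_edgeSet e.2
    exact ⟨⟨x, hxy.left_mem⟩, ⟨y, hxy.right_mem⟩, hxy⟩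
  choose x y hxy using h
  exact ⟨fun h => if h.2 then y h.1 else x h.1, fun e => by simpa using hxy e⟩

variable {φ : G.edgeSet × Bool → G.vertexSet}

open Classical in
lemma vertexDegree_restrict (hφ : ∀ e : G.edgeSet, G.IsLink e (φ (e, false)) (φ (e, true)))
    (s : Finset G.edgeSet) (v : G.vertexSet) :
    (G.restrict (Subtype.val '' (s : Set G.edgeSet))).vertexDegree v = halfDegree φ s v := by
  have h1 : {e | (G.restrict (Subtype.val '' (s : Set G.edgeSet))).IsNonloopAt e v} =
      Subtype.val '' (({e ∈ s | ¬(φ (e, false) = v ↔ φ (e, true) = v)} : Finset G.edgeSet) :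
        Set G.edgeSet) := by
    ext e
    constructor
    · rintro ⟨y, hy, hl⟩
      obtain ⟨⟨e', he', rfl⟩, hl⟩ : e ∈ Subtype.val '' (s : Set G.edgeSet) ∧ G.IsLink e v y := hl
      refine ⟨e', ?_, rfl⟩
      simp only [coe_filter, Set.mem_ofPred_eq]
      refine ⟨he', fun hiff => hy ?_⟩
      rcases (hφ e').eq_and_eq_or_eq_and_eq hl with ⟨h, h'⟩ | ⟨h, h'⟩
      · rw [← h', hiff.1 (Subtype.ext h)]
      · rw [← h, hiff.2 (Subtype.ext h')]
    · rintro ⟨e', he', rfl⟩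
      simp only [coe_filter, Set.mem_ofPred_eq] at he'
      have hl := hφ e'
      by_cases h : φ (e', false) = v
      · have h' : φ (e', true) ≠ v := by tauto
        refine ⟨φ (e', true), fun hh => h' (Subtype.ext hh), ?_⟩
        rw [h] at hl
        exact ⟨⟨e', he'.1, rfl⟩, hl⟩
      · have h' : φ (e', true) = v := by tauto
        refine ⟨φ (e', false), fun hh => h (Subtype.ext hh), ?_⟩
        rw [h'] at hl
        exact ⟨⟨e', he'.1, rfl⟩, hl.symm⟩
  have h2 : {e | (G.restrict (Subtype.val '' (s : Set G.edgeSet))).IsLoopAt e v} =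
      Subtype.val '' (({e ∈ s | φ (e, false) = v ∧ φ (e, true) = v} : Finset G.edgeSet) :
        Set G.edgeSet) := by
    ext e
    constructor
    · intro hl
      obtain ⟨⟨e', he', rfl⟩, hl⟩ : e ∈ Subtype.val '' (s : Set G.edgeSet) ∧ G.IsLink e v v := hl
      refine ⟨e', ?_, rfl⟩
      simp only [coe_filter, Set.mem_ofPred_eq]
      rcases (hφ e').eq_and_eq_or_eq_and_eq hl with ⟨h, h'⟩ | ⟨h, h'⟩
      · exact ⟨he', Subtype.ext h, Subtype.ext h'⟩
      · exact ⟨he', Subtype.ext h, Subtype.ext h'⟩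
    · rintro ⟨e', he', rfl⟩
      simp only [coe_filter, Set.mem_ofPred_eq] at he'
      have hl := hφ e'
      rw [he'.2.1, he'.2.2] at hl
      exact ⟨⟨e', he'.1, rfl⟩, hl⟩
  rw [Graph.vertexDegree, h1, h2, Set.ncard_image_of_injective _ Subtype.val_injective,
    Set.ncard_image_of_injective _ Subtype.val_injective, Set.ncard_coe_finset,
    Set.ncard_coe_finset, halfDegree, endDegree, endDegree]
  simp only [card_filter, mul_sum, ← sum_add_distrib]
  refine sum_congr rfl fun e _ => ?_
  by_cases ha : φ (e, false) = v <;> by_cases hb : φ (e, true) = v <;> simp [ha, hb]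

open Classical in
lemma vertexDegree_eq [Fintype G.edgeSet]
    (hφ : ∀ e : G.edgeSet, G.IsLink e (φ (e, false)) (φ (e, true))) (v : G.vertexSet) :
    G.vertexDegree v = halfDegree φ univ v := by
  rw [← vertexDegree_restrict hφ, coe_univ, Set.image_univ, Subtype.range_coe, Graph.restrict_self]

lemma cutDegree_eq [Fintype G.edgeSet]
    (hφ : ∀ e : G.edgeSet, G.IsLink e (φ (e, false)) (φ (e, true))) (A : Finset G.vertexSet) :
    G.cutDegree (Subtype.val '' (A : Set G.vertexSet)) = cutCard φ A := by
  classical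
  have hmem : ∀ x : G.vertexSet, (x : α) ∈ Subtype.val '' (A : Set G.vertexSet) ↔ x ∈ A := by
    intro x
    simp
  have h1 : {e | ∃ x y, G.IsLink e x y ∧ x ∈ Subtype.val '' (A : Set G.vertexSet) ∧
      y ∉ Subtype.val '' (A : Set G.vertexSet)} =
      Subtype.val '' (({e | ¬(φ (e, false) ∈ A ↔ φ (e, true) ∈ A)} : Finset G.edgeSet) :
        Set G.edgeSet) := by
    ext e
    constructor
    · rintro ⟨x, y, hl, hx, hy⟩
      refine ⟨⟨e, hl.edge_mem⟩, ?_, rfl⟩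
      simp only [coe_filter, mem_univ, true_and, Set.mem_ofPred_eq]
      rw [← hmem, ← hmem]
      rcases (hφ ⟨e, hl.edge_mem⟩).eq_and_eq_or_eq_and_eq hl with ⟨h, h'⟩ | ⟨h, h'⟩ <;>
        rw [h, h'] <;> tauto
    · rintro ⟨e', he', rfl⟩
      simp only [coe_filter, mem_univ, true_and, Set.mem_ofPred_eq] at he'
      by_cases h : φ (e', false) ∈ A
      · exact ⟨_, _, hφ e', (hmem _).2 h, fun h' => by rw [hmem] at h'; tauto⟩
      · exact ⟨_, _, (hφ e').symm, (hmem _).2 (by tauto), fun h' => h ((hmem _).1 h')⟩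
  rw [Graph.cutDegree, h1, Set.ncard_image_of_injective _ Subtype.val_injective,
    Set.ncard_coe_finset, cutCard, card_filter, card_filter, Fintype.sum_prod_type]
  refine sum_congr rfl fun e _ => ?_
  by_cases ha : φ (e, false) ∈ A <;> by_cases hb : φ (e, true) ∈ A <;>
    simp [partner, ha, hb]

lemma isFactorization_restrict {ι : Type*} [Fintype G.edgeSet] [DecidableEq ι]
    (c : G.edgeSet → ι) : G.IsFactorization fun i =>
      G.restrict (Subtype.val '' (({e | c e = i} : Finset G.edgeSet) : Set G.edgeSet)) where
  spanning i := ⟨Graph.restrict_le, rfl⟩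
  disjoint i j hij := by
    rw [Set.disjoint_left]
    rintro e ⟨-, e₁, h₁, rfl⟩ ⟨-, e₂, h₂, he⟩
    simp only [coe_filter, mem_univ, true_and, Set.mem_ofPred_eq] at h₁ h₂
    rw [Subtype.ext he] at h₂
    exact hij (h₁.symm.trans h₂)
  cover := by
    ext e
    simp only [Set.mem_iUnion]
    constructor
    · rintro ⟨i, h, -⟩
      exact h
    · intro h
      exact ⟨c ⟨e, h⟩, h, ⟨e, h⟩, by simp, rfl⟩

end Transfer

section Factorization

variable {α β : Type*}

/-- The colour classes of `exists_completion`, as subgraphs of the multigraph, with `F` as the class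
of index zero. -/
theorem exists_factorization_of_first {G : Graph α β} [Fintype G.vertexSet] [Fintype G.edgeSet]
    [DecidableEq G.vertexSet] {φ : G.edgeSet × Bool → G.vertexSet}
    (hφ : ∀ e : G.edgeSet, G.IsLink e (φ (e, false)) (φ (e, true))) {K : ℕ}
    (ε : Fin (K + 1) → ℝ) (hsum : ∑ i, ε i = 1) (heq : ∀ i j, i ≠ 0 → j ≠ 0 → ε i = ε j)
    (F : Finset G.edgeSet) (hF0 : K = 0 → F = univ)
    (hF : ∀ v, |(halfDegree φ F v : ℝ) - ε 0 * halfDegree φ univ v| < 2 ∧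
      (Even (halfDegree φ univ v) → Even (halfDegree φ F v))) :
    ∃ H : Fin (K + 1) → Graph α β, G.IsFactorization H ∧
      (∀ v ∈ G.vertexSet, ∀ i,
        |((H i).vertexDegree v : ℝ) - ε i * (G.vertexDegree v : ℝ)| < 2) ∧
      (∀ v ∈ G.vertexSet, ∀ i j,
        Odd ((H i).vertexDegree v) → Odd ((H j).vertexDegree v) → i = j) ∧
      (∀ v ∈ G.vertexSet, Even (G.vertexDegree v) → ∀ i, Even ((H i).vertexDegree v)) ∧
      ∀ v : G.vertexSet, (H 0).vertexDegree v = halfDegree φ F v := by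
  classical
  obtain ⟨c, hc0, hc⟩ := exists_completion φ ε hsum heq F hF0 hF
  have hdeg : ∀ (i : Fin (K + 1)) (v : G.vertexSet),
      (G.restrict (Subtype.val '' (({e | c e = i} : Finset G.edgeSet) :
        Set G.edgeSet))).vertexDegree v = halfDegree φ {e | c e = i} v := fun i v => by
    rw [vertexDegree_restrict hφ]
    congr!
  have hdegG : ∀ v : G.vertexSet, G.vertexDegree v = halfDegree φ univ v := fun v => by
    rw [vertexDegree_eq hφ]
    congr!
  refine ⟨_, isFactorization_restrict c, fun v hv i => ?_, fun v hv i j => ?_,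
    fun v hv heven i => ?_, fun v => ?_⟩
  · rw [hdeg i ⟨v, hv⟩, hdegG ⟨v, hv⟩]
    exact (hc ⟨v, hv⟩).1 i
  · rw [hdeg i ⟨v, hv⟩, hdeg j ⟨v, hv⟩]
    exact (hc ⟨v, hv⟩).2 i j
  · have hval : ∀ i : Fin (K + 1),
        ({e | c e = i} : Finset G.edgeSet) = ({e | (c e).val = i.val} : Finset G.edgeSet) :=
      fun i => by simp only [Fin.ext_iff]
    rw [hdegG ⟨v, hv⟩, halfDegree_eq_sum_fiber φ univ (fun e => (c e).val) (K + 1)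
      fun e _ => (c e).isLt] at heven
    rw [hdeg i ⟨v, hv⟩, hval]
    refine even_of_sum_even _ heven (fun a ha b hb hoa hob => ?_) i.isLt
    have := (hc ⟨v, hv⟩).2 ⟨a, ha⟩ ⟨b, hb⟩
    rw [hval, hval] at this
    exact Fin.ext_iff.1 (this hoa hob)
  · rw [hdeg, hc0]

lemma eq_one_of_sum_eq_one {ε : Fin (0 + 1) → ℝ} (hsum : ∑ i, ε i = 1) : ε 0 = 1 := by
  simpa using hsum

lemma le_one_of_sum_eq_one {K : ℕ} {ε : Fin (K + 1) → ℝ} (h0 : ∀ i, 0 ≤ ε i)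
    (hsum : ∑ i, ε i = 1) : ε 0 ≤ 1 :=
  hsum ▸ single_le_sum (fun i _ => h0 i) (mem_univ 0)

theorem exists_factorization {G : Graph α β} (hV : G.vertexSet.Finite) (hE : G.edgeSet.Finite)
    {K : ℕ} (ε : Fin (K + 1) → ℝ) (h0 : ∀ i, 0 ≤ ε i) (hsum : ∑ i, ε i = 1)
    (heq : ∀ i j, i ≠ 0 → j ≠ 0 → ε i = ε j) :
    ∃ H : Fin (K + 1) → Graph α β, G.IsFactorization H ∧
      (∀ v ∈ G.vertexSet, ∀ i,
        |((H i).vertexDegree v : ℝ) - ε i * (G.vertexDegree v : ℝ)| < 2) ∧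
      (∀ v ∈ G.vertexSet, ∀ i j,
        Odd ((H i).vertexDegree v) → Odd ((H j).vertexDegree v) → i = j) ∧
      (∀ v ∈ G.vertexSet, Even (G.vertexDegree v) → ∀ i, Even ((H i).vertexDegree v)) := by
  classical
  have := hV.fintype
  have := hE.fintype
  obtain ⟨φ, hφ⟩ := exists_ends G
  obtain ⟨F, hF0, hF⟩ : ∃ F : Finset G.edgeSet, (K = 0 → F = univ) ∧
      ∀ v, |(halfDegree φ F v : ℝ) - ε 0 * halfDegree φ univ v| < 2 ∧
        (Even (halfDegree φ univ v) → Even (halfDegree φ F v)) := by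
    rcases Nat.eq_zero_or_pos K with rfl | hK
    · exact ⟨univ, fun _ => rfl, fun v => ⟨by simp [eq_one_of_sum_eq_one hsum], id⟩⟩
    · obtain ⟨F, hF⟩ := exists_fraction_even φ (ε 0) (h0 0) (le_one_of_sum_eq_one h0 hsum)
      exact ⟨F, fun h => absurd h hK.ne', hF⟩
  obtain ⟨H, h1, h2, h3, h4, -⟩ := exists_factorization_of_first hφ ε hsum heq F hF0 hF
  exact ⟨H, h1, h2, h3, h4⟩

theorem exists_factorization_of_oddEdgeConnected {G : Graph α β} (hV : G.vertexSet.Finite)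
    (hE : G.edgeSet.Finite) {K : ℕ} (ε : Fin (K + 1) → ℝ) (h0 : ∀ i, 0 ≤ ε i)
    (hsum : ∑ i, ε i = 1) (heq : ∀ i j, i ≠ 0 → j ≠ 0 → ε i = ε j) (hpos : 0 < ε 0)
    (hconn : G.OddEdgeConnected ⌈1 / ε 0⌉₊) :
    ∃ H : Fin (K + 1) → Graph α β, G.IsFactorization H ∧
      (∀ v ∈ G.vertexSet, ∀ i,
        |((H i).vertexDegree v : ℝ) - ε i * (G.vertexDegree v : ℝ)| < 2) ∧
      (∀ v ∈ G.vertexSet, ∀ i j,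
        Odd ((H i).vertexDegree v) → Odd ((H j).vertexDegree v) → i = j) ∧
      (∀ v ∈ G.vertexSet, Even (G.vertexDegree v) → ∀ i, Even ((H i).vertexDegree v)) ∧
      (∀ v ∈ G.vertexSet, Odd (G.vertexDegree v) → Odd ((H 0).vertexDegree v)) := by
  classical
  have := hV.fintype
  have := hE.fintype
  obtain ⟨φ, hφ⟩ := exists_ends G
  obtain ⟨F, hF0, hF⟩ : ∃ F : Finset G.edgeSet, (K = 0 → F = univ) ∧
      ∀ v, |(halfDegree φ F v : ℝ) - ε 0 * halfDegree φ univ v| < 2 ∧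
        (Even (halfDegree φ F v) ↔ Even (halfDegree φ univ v)) := by
    rcases eq_or_lt_of_le (le_one_of_sum_eq_one h0 hsum) with h1 | h1
    · exact ⟨univ, fun _ => rfl, fun v => ⟨by simp [h1], Iff.rfl⟩⟩
    · obtain ⟨F, hF⟩ := exists_parity_fraction φ (ε 0) (h0 0) h1 fun A hA => by
        rw [← cutDegree_eq hφ] at hA ⊢
        have h2 := Nat.ceil_le.1 (hconn _ (by rintro _ ⟨v, -, rfl⟩; exact v.2) hA)
        rw [div_le_iff₀ hpos] at h2
        linarith
      refine ⟨F, ?_, hF⟩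
      rintro rfl
      exact absurd (eq_one_of_sum_eq_one hsum) h1.ne
  obtain ⟨H, h1, h2, h3, h4, h0⟩ := exists_factorization_of_first hφ ε hsum heq F hF0
    fun v => ⟨(hF v).1, (hF v).2.2⟩
  refine ⟨H, h1, h2, h3, h4, fun v hv hodd => ?_⟩
  rw [h0 ⟨v, hv⟩, ← Nat.not_even_iff_odd, (hF ⟨v, hv⟩).2]
  have h5 : G.vertexDegree v = halfDegree φ univ ⟨v, hv⟩ := vertexDegree_eq hφ ⟨v, hv⟩
  rwa [← h5, Nat.not_even_iff_odd]

end Factorization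

end EquitableFactor

theorem mainTheorem10 {α β : Type*} (G : Graph α β)
    (hV : G.vertexSet.Finite) (hE : G.edgeSet.Finite) (k : ℕ) [NeZero k] :
    -- general weights whose members, except possibly the first, are all equal
    (∀ ε : Fin k → ℝ, (∀ i, 0 ≤ ε i) → ∑ i, ε i = 1 →
      (∀ i j, i ≠ 0 → j ≠ 0 → ε i = ε j) →
      (∃ F : Fin k → Graph α β, G.IsFactorization F ∧
        (∀ v ∈ G.vertexSet, ∀ i,
          |((F i).vertexDegree v : ℝ) - ε i * (G.vertexDegree v : ℝ)| < 2) ∧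
        (∀ v ∈ G.vertexSet, ∀ i j,
          Odd ((F i).vertexDegree v) → Odd ((F j).vertexDegree v) → i = j)) ∧
      (0 < ε 0 → G.OddEdgeConnected ⌈1 / ε 0⌉₊ →
        ∃ F : Fin k → Graph α β, G.IsFactorization F ∧
          (∀ v ∈ G.vertexSet, ∀ i,
            |((F i).vertexDegree v : ℝ) - ε i * (G.vertexDegree v : ℝ)| < 2) ∧
          (∀ v ∈ G.vertexSet, ∀ i j,
            Odd ((F i).vertexDegree v) → Odd ((F j).vertexDegree v) → i = j) ∧
          (∀ v ∈ G.vertexSet, Odd (G.vertexDegree v) → Odd ((F 0).vertexDegree v)))) ∧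
    -- equal weights
    (∃ F : Fin k → Graph α β, G.IsFactorization F ∧
      (∀ v ∈ G.vertexSet, ∀ i,
        |((F i).vertexDegree v : ℝ) - (G.vertexDegree v : ℝ) / (k : ℝ)| < 2) ∧
      (∀ v ∈ G.vertexSet, ∀ i j,
        Odd ((F i).vertexDegree v) → Odd ((F j).vertexDegree v) → i = j) ∧
      (∀ v ∈ G.vertexSet, Even (G.vertexDegree v) → ∀ i, Even ((F i).vertexDegree v))) ∧
    (G.OddEdgeConnected k →
      ∃ F : Fin k → Graph α β, G.IsFactorization F ∧
        (∀ v ∈ G.vertexSet, ∀ i,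
          |((F i).vertexDegree v : ℝ) - (G.vertexDegree v : ℝ) / (k : ℝ)| < 2) ∧
        (∀ v ∈ G.vertexSet, (F 0).vertexDegree v ≡ G.vertexDegree v [MOD 2]) ∧
        (∀ v ∈ G.vertexSet, ∀ i, i ≠ 0 → Even ((F i).vertexDegree v))) := by
  obtain ⟨K, rfl⟩ : ∃ K, k = K + 1 := Nat.exists_eq_succ_of_ne_zero (NeZero.ne k)
  have hk : (0 : ℝ) < ((K + 1 : ℕ) : ℝ) := by positivity
  have hsum : ∑ _i : Fin (K + 1), 1 / ((K + 1 : ℕ) : ℝ) = 1 := by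
    rw [Finset.sum_const, Finset.card_univ, Fintype.card_fin, nsmul_eq_mul]
    field_simp
  refine ⟨fun ε h0 hs heq => ⟨?_, fun hpos hconn => ?_⟩, ?_, fun hconn => ?_⟩
  · obtain ⟨F, h1, h2, h3, -⟩ := EquitableFactor.exists_factorization hV hE ε h0 hs heq
    exact ⟨F, h1, h2, h3⟩
  · obtain ⟨F, h1, h2, h3, -, h5⟩ :=
      EquitableFactor.exists_factorization_of_oddEdgeConnected hV hE ε h0 hs heq hpos hconn
    exact ⟨F, h1, h2, h3, h5⟩
  · obtain ⟨F, h1, h2, h3, h4⟩ := EquitableFactor.exists_factorization hV hE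
      (fun _ : Fin (K + 1) => 1 / ((K + 1 : ℕ) : ℝ)) (fun _ => by positivity) hsum
      fun _ _ _ _ => rfl
    refine ⟨F, h1, fun v hv i => ?_, h3, h4⟩
    have := h2 v hv i
    rwa [one_div_mul_eq_div] at this
  · obtain ⟨F, h1, h2, h3, h4, h5⟩ := EquitableFactor.exists_factorization_of_oddEdgeConnected hV hE
      (fun _ : Fin (K + 1) => 1 / ((K + 1 : ℕ) : ℝ)) (fun _ => by positivity) hsum
      (fun _ _ _ _ => rfl) (by positivity) (by rwa [one_div_one_div, Nat.ceil_natCast])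
    refine ⟨F, h1, fun v hv i => ?_, fun v hv => ?_, fun v hv i hi => ?_⟩
    · have := h2 v hv i
      rwa [one_div_mul_eq_div] at this
    · rcases Nat.even_or_odd (G.vertexDegree v) with h | h
      · exact (Nat.even_iff.1 (h4 v hv h 0)).trans (Nat.even_iff.1 h).symm
      · exact (Nat.odd_iff.1 (h5 v hv h)).trans (Nat.odd_iff.1 h).symm
    · rcases Nat.even_or_odd (G.vertexDegree v) with h | h
      · exact h4 v hv h i
      · rw [← Nat.not_odd_iff_even]
        exact fun hi' => hi (h3 v hv i 0 hi' (h5 v hv h))
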